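/- Let $(H,(\cdot,\cdot))$ be a complex Hilbert space and let $T$ be a self-adjoint (possibly unbounded) operator in $H$ that is boundedly invertible, i.e. $T:\operatorname{dom}T\to H$ is bijective with bounded inverse. Definitions. A Kreĭn space is a complex vector space $K$ with a Hermitian sesquilinear form $[\cdot,\cdot]$ that has a fundamental decomposition: $K=K^+\oplus K^-$, a direct and $[\cdot,\cdot]$-orthogonal sum in which $(K^+,[\cdot,\cdot])$ and $(K^-,-[\cdot,\cdot])$ are Hilbert spaces. With the projections $P^\pm$ onto $K^\pm$ along $K^\mp$ and $J=P^+-P^-$, its topology is that of the Hilbert space $(K,[J\cdot,\cdot])$; it does not depend on the decomposition. For a densely defined symmetric sesquilinear form $\mathfrak t$ in $H$ and $\lambda\in\mathbb R$ put $\mathfrak t_\lambda=\mathfrak t-\lambda(\cdot,\cdot)$ on $\operatorname{dom}\mathfrak t$. The number $\lambda$ is a gap point of $\mathfrak t$ if $(\operatorname{dom}\mathfrak t,\mathfrak t_\lambda)$ is a Kreĭn space continuously embedded in $H$; $\mathfrak t$ is closed if it has a gap point. A closure of a form $\mathfrak s$ is a closed extension $\mathfrak t$ of $\mathfrak s$ such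 that $\operatorname{dom}\mathfrak s$ is dense in the Kreĭn space $(\operatorname{dom}\mathfrak t,\mathfrak t_\lambda)$ for some gap point $\lambda$. The operator $T$ is semibounded if there is $c\in\mathbb R$ such that $(Tf,f)\ge c(f,f)$ for all $f\in\operatorname{dom}T$, or $(Tf,f)\le c(f,f)$ for all $f\in\operatorname{dom}T$. Let - $\mathcal M_T$ be the set of all closures in $H$ of the form $(T\cdot,\cdot)$ with domain $\operatorname{dom}T$; - $\mathcal K_T$ be the set of all Kreĭn space completions of $(\operatorname{dom}T,(T\cdot,\cdot))$ continuously embedded in $H$, i.e. of all Kreĭn spaces $(K,[\cdot,\cdot])$ such that $K$ is a linear subspace of $H$ with continuous inclusion, $\operatorname{dom}T\subseteq K$ is dense in $(K,[\cdot,\cdot])$, and $[f,g]=(Tf,g)$ for $f,g\in\operatorname{dom}T$; - $\mathcal N_T$ be the set of all triples $(K,[\cdot,\cdot],A)$ with $(K,[\cdot,\cdot])\in\mathcal K_T$, $\operatorname{dom}A=T^{-1}(K)$ and $A=T|_{\operatorname{dom}A}$. Theorem. The form $(T\cdot,\cdot)$ has a unique closure (that is, $\mathcal M_T$ has exactly one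 element) if and only if $T$ is semibounded. Likewise, $(\operatorname{dom}T,(T\cdot,\cdot))$ has a unique Kreĭn space completion continuously embedded in $H$ (that is, $\mathcal K_T$ has exactly one element) if and only if $T$ is semibounded, and $\mathcal N_T$ has exactly one element if and only if $T$ is semibounded. -/

import Mathlib

open scoped InnerProductSpace ComplexConjugate

namespace KreinForm

universe u

/-- A sesquilinear form on `V`, conjugate-linear in the first argument (Mathlib's convention for
inner products). -/
abbrev Sesq (V : Type u) [AddCommGroup V] [Module ℂ V] : Type u := V →ₗ⋆[ℂ] V →ₗ[ℂ] ℂ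

section Krein

variable {V : Type u} [AddCommGroup V] [Module ℂ V]

/-- `(V, B)` is a Hilbert space: `B` is a (positive definite) inner product, and `V` is complete
for the norm it induces. -/
def IsHilbertSpace (B : Sesq V) : Prop :=
  ∃ c : InnerProductSpace.Core ℂ V, (∀ x y, c.inner x y = B x y) ∧
    @CompleteSpace V c.toNormedAddCommGroup.toMetricSpace.toUniformSpace

/-- A fundamental decomposition `V = V⁺ ⊕ V⁻` of an indefinite inner product space `(V, B)`:
the sum is direct and `B`-orthogonal, `(V⁺, B)` and `(V⁻, -B)` are Hilbert spaces.
A Kreĭn space is an indefinite inner product space that has such a decomposition. -/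
structure FundamentalDecomposition (B : Sesq V) where
  pos : Submodule ℂ V
  neg : Submodule ℂ V
  hermitian : ∀ x y, conj (B x y) = B y x
  isCompl : IsCompl pos neg
  orthogonal : ∀ x ∈ pos, ∀ y ∈ neg, B x y = 0
  hilbert_pos : IsHilbertSpace (B.domRestrict₁₂ pos pos)
  hilbert_neg : IsHilbertSpace (-(B.domRestrict₁₂ neg neg))

namespace FundamentalDecomposition

variable {B : Sesq V} (F : FundamentalDecomposition B)

/-- The fundamental symmetry `J = P⁺ - P⁻`. -/
noncomputable def J : V →ₗ[ℂ] V :=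
  F.pos.projection F.neg F.isCompl - F.neg.projection F.pos F.isCompl.symm

/-- The squared norm `{x, x} = B (J x) x` of the Hilbert space attached to the decomposition. Its
topology is the topology of the Kreĭn space; it does not depend on the decomposition. -/
noncomputable def normSq (x : V) : ℝ := (B (F.J x) x).re

/-- `S` is dense in the Kreĭn space. -/
def IsDense (S : Set V) : Prop :=
  ∀ x : V, ∀ ε > 0, ∃ y ∈ S, F.normSq (x - y) < ε

end FundamentalDecomposition

end Krein

variable {H : Type u} [NormedAddCommGroup H] [InnerProductSpace ℂ H]

/-- The inclusion into `H` of the Kreĭn space `(K, B)`, whose topology is read off from a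
fundamental decomposition, is continuous. -/
def FundamentalDecomposition.EmbedsContinuously {K : Submodule ℂ H} {B : Sesq K}
    (F : FundamentalDecomposition B) : Prop :=
  ∃ C : ℝ, ∀ x : K, ‖(x : H)‖ ^ 2 ≤ C * F.normSq x

variable (H) in
/-- A densely defined symmetric sesquilinear form in `H`. -/
structure SymForm where
  domain : Submodule ℂ H
  form : Sesq domain
  dense : Dense (domain : Set H)
  symm : ∀ x y, conj (form x y) = form y x

namespace SymForm

/-- The form `t_lam = t - lam (·,·)` on `dom t`. -/
noncomputable def shift (t : SymForm H) (lam : ℝ) : Sesq t.domain :=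
  t.form - (lam : ℂ) • (innerₛₗ ℂ : Sesq H).domRestrict₁₂ t.domain t.domain

/-- `lam` is a gap point of `t`: `(dom t, t_lam)` is a Kreĭn space continuously embedded in `H`. -/
def IsGapPoint (t : SymForm H) (lam : ℝ) : Prop :=
  ∃ F : FundamentalDecomposition (t.shift lam), F.EmbedsContinuously

/-- A closed form: one with a gap point. -/
def IsClosed (t : SymForm H) : Prop := ∃ lam : ℝ, t.IsGapPoint lam

/-- `t` is an extension of `s`. -/
def IsExtension (s t : SymForm H) : Prop :=
  ∃ h : s.domain ≤ t.domain, ∀ x y : s.domain,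
    t.form (Submodule.inclusion h x) (Submodule.inclusion h y) = s.form x y

/-- `t` is a closure of `s`: a closed extension of `s` such that `dom s` is dense in the Kreĭn
space `(dom t, t_lam)` for some gap point `lam`. -/
def IsClosure (s t : SymForm H) : Prop :=
  t.IsClosed ∧ IsExtension s t ∧
    ∃ (lam : ℝ) (F : FundamentalDecomposition (t.shift lam)),
      F.EmbedsContinuously ∧ F.IsDense {x : t.domain | (x : H) ∈ s.domain}

end SymForm

variable (H) in
/-- A linear subspace `K` of `H` with a sesquilinear form `[·,·]` on it. -/
structure FormSubspace where
  space : Submodule ℂ H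
  form : Sesq space

variable (H) in
/-- A linear subspace `K` of `H` with a sesquilinear form on it and an operator in `K`. -/
structure FormSubspaceOp extends FormSubspace H where
  op : space →ₗ.[ℂ] space

/-- `(K, [·,·])` is a Kreĭn space completion of the inner product space `(dom s, s)` that is
continuously embedded in `H`. -/
def IsKreinCompletion (s : SymForm H) (k : FormSubspace H) : Prop :=
  (∃ h : s.domain ≤ k.space, ∀ x y : s.domain,
    k.form (Submodule.inclusion h x) (Submodule.inclusion h y) = s.form x y) ∧
  ∃ F : FundamentalDecomposition k.form,
    F.EmbedsContinuously ∧ F.IsDense {x : k.space | (x : H) ∈ s.domain}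

/-- `A` is the range restriction of `T` to `K`: `dom A = T⁻¹(K)` and `A = T` on `dom A`. Here
`A` is an operator in `K`, so `dom A` consists of elements of `K`; when `dom T ⊆ K` this is
no restriction. -/
def IsRangeRestriction (T : H →ₗ.[ℂ] H) {K : Submodule ℂ H} (A : K →ₗ.[ℂ] K) : Prop :=
  (∀ x : K, x ∈ A.domain ↔ ∃ h : (x : H) ∈ T.domain, T ⟨x, h⟩ ∈ K) ∧
  ∀ (x : A.domain) (h : ((x : K) : H) ∈ T.domain), (A x : H) = T ⟨x, h⟩

/-- `T` is boundedly invertible: it is a bijection of `dom T` onto `H` with bounded inverse. -/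
def BoundedlyInvertible (T : H →ₗ.[ℂ] H) : Prop :=
  ∃ S : H →L[ℂ] H, (∀ x : T.domain, S (T x) = x) ∧
    ∀ y : H, ∃ h : S y ∈ T.domain, T ⟨S y, h⟩ = y

/-- `T` is semibounded, from below or from above. -/
def Semibounded (T : H →ₗ.[ℂ] H) : Prop :=
  ∃ c : ℝ, (∀ x : T.domain, c * ‖(x : H)‖ ^ 2 ≤ (⟪T x, (x : H)⟫_ℂ).re) ∨
    (∀ x : T.domain, (⟪T x, (x : H)⟫_ℂ).re ≤ c * ‖(x : H)‖ ^ 2)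

variable [CompleteSpace H]

/-- The form `(T·,·)` on `dom T` of a self-adjoint operator `T`. -/
noncomputable def operatorForm (T : H →ₗ.[ℂ] H) (hT : IsSelfAdjoint T) : SymForm H where
  domain := T.domain
  form := ((innerₛₗ ℂ : Sesq H).comp T.toFun).domRestrict₂ T.domain
  dense := hT.dense_domain
  symm x y := by
    have h := LinearPMap.adjoint_isFormalAdjoint (T := T) hT.dense_domain
    rw [LinearPMap.isSelfAdjoint_def.mp hT] at h
    exact (inner_conj_symm (y : H) (T x)).trans (h y x).symm

/-- All closures of `(T·,·)` in `H`. -/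
def closures (T : H →ₗ.[ℂ] H) (hT : IsSelfAdjoint T) : Set (SymForm H) :=
  {t | (operatorForm T hT).IsClosure t}

/-- All Kreĭn space completions of `(dom T, (T·,·))` continuously embedded in `H`. -/
def completions (T : H →ₗ.[ℂ] H) (hT : IsSelfAdjoint T) : Set (FormSubspace H) :=
  {k | IsKreinCompletion (operatorForm T hT) k}

/-- All triples `(K, [·,·], A)` of a Kreĭn space completion `(K, [·,·])` of `(dom T, (T·,·))`
continuously embedded in `H` and the range restriction `A` of `T` to `K`. -/
def completionsOp (T : H →ₗ.[ℂ] H) (hT : IsSelfAdjoint T) : Set (FormSubspaceOp H) :=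
  {k | IsKreinCompletion (operatorForm T hT) k.toFormSubspace ∧ IsRangeRestriction T k.op}

end KreinForm

/-! Everything is read off from the bounded self-adjoint operator `S = T⁻¹`. If `S = D j D*` with
`D` bounded and injective from a Hilbert space into `H` and `j` a symmetric involution, then the
range of `D` with the form `(D x, D y) ↦ ⟪j x, y⟫` is a Kreĭn space completion of `(dom T, (T·,·))`.
The choice `D = R = |S|^(1/2)`, `j = J = sign S` always works, so a completion exists.

Let `T` be semibounded. A suitable `T - m` is semidefinite and onto. In the Hilbert space of any
closure the form shifted by `m` is given by a bounded operator `G`, which inherits both properties,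
and a semidefinite operator that is onto is uniformly definite. So on `dom T` the norm of any
closure is controlled by the shifted form, which in turn is controlled by the norm of any other
closure. The identity of `dom T` therefore extends to a bounded map between the two spaces that
respects the inclusions into `H`; each closure extends the other (`exists_norm_sq_le_form`,
`isExtension_of_semibounded`).

Let `T` not be semibounded. Then the spectrum of `S` accumulates at zero from both sides, which
yields orthonormal `u n`, `v n` in the positive and negative spectral parts with `‖R (u n)‖, ‖R (v
n)‖ ≤ 8⁻ⁿ`. The neutral vectors `p n, q n = (u n ± v n) / √2` are exchanged by `J`. The hyperbolic
rotation `V` with `p n ↦ 4ⁿ p n`, `q n ↦ 4⁻ⁿ q n` formally satisfies `V J V = J`; it is unbounded,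
but `D = R V` is bounded because `4ⁿ 8⁻ⁿ` is summable. Hence `D J D* = R J R = S` is a second
factorization, and the range of `D` is not inside that of `R` (`exists_factorization`).

Completions are closures with gap point zero, and the operator in a triple is determined by the
space. So uniqueness of closures and a second completion settle all three equivalences. -/

open scoped InnerProductSpace ComplexConjugate

namespace KreinForm

universe u

/-! ### Kreĭn spaces as Hilbert spaces with a symmetric involution -/

section Krein

variable {V : Type u} [AddCommGroup V] [Module ℂ V]

/-- A form that is carried to the inner product of a Hilbert space by a linear bijection makes its
space a Hilbert space. -/
theorem isHilbertSpace_of_equiv {B : Sesq V} {E : Type*} [NormedAddCommGroup E]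
    [InnerProductSpace ℂ E] [CompleteSpace E] (e : E ≃ₗ[ℂ] V)
    (h : ∀ x y, B (e x) (e y) = ⟪x, y⟫_ℂ) : IsHilbertSpace B := by
  have h' : ∀ x y, B x y = ⟪e.symm x, e.symm y⟫_ℂ := fun x y => by
    rw [← h, e.apply_symm_apply, e.apply_symm_apply]
  let c : InnerProductSpace.Core ℂ V :=
    { inner := fun x y => B x y
      conj_inner_symm := fun x y => by
        simp only [h']
        exact inner_conj_symm _ _
      re_inner_nonneg := fun x => by
        simp only [h']
        exact inner_self_nonneg
      add_left := fun x y z => by simp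
      smul_left := fun x y r => by simp
      definite := fun x hx => by
        simp only [h'] at hx
        simpa using hx }
  refine ⟨c, fun _ _ => rfl, ?_⟩
  let := c.toNormedAddCommGroup
  let : InnerProductSpace ℂ V := InnerProductSpace.ofCore c.toCore
  have hn : ∀ x : E, ‖e x‖ = ‖x‖ := fun x => by
    have h1 : ⟪e x, e x⟫_ℂ = ⟪x, x⟫_ℂ := h x x
    rw [inner_self_eq_norm_sq_to_K, inner_self_eq_norm_sq_to_K] at h1
    have h2 : ‖e x‖ ^ 2 = ‖x‖ ^ 2 := by exact_mod_cast h1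
    exact (sq_eq_sq₀ (norm_nonneg _) (norm_nonneg _)).1 h2
  let f : E ≃ₗᵢ[ℂ] V := ⟨e, hn⟩
  exact f.toIsometryEquiv.completeSpace_iff.1 inferInstance

/-- A form that makes its space a Hilbert space is the inner product of a Hilbert space. -/
theorem IsHilbertSpace.exists_equiv {B : Sesq V} (hB : IsHilbertSpace B) :
    ∃ (E : Type u) (_ : NormedAddCommGroup E) (_ : InnerProductSpace ℂ E) (_ : CompleteSpace E)
      (e : E ≃ₗ[ℂ] V), ∀ x y, B (e x) (e y) = ⟪x, y⟫_ℂ := by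
  obtain ⟨c, hc, hcomp⟩ := hB
  let := c.toNormedAddCommGroup
  let : InnerProductSpace ℂ V := InnerProductSpace.ofCore c.toCore
  exact ⟨V, inferInstance, inferInstance, hcomp, LinearEquiv.refl ℂ V, fun x y => (hc x y).symm⟩

namespace FundamentalDecomposition

variable {B : Sesq V}

theorem J_apply_of_mem (F : FundamentalDecomposition B) {x y : V} (hx : x ∈ F.pos)
    (hy : y ∈ F.neg) : F.J (x + y) = x - y := by
  simp only [J, LinearMap.sub_apply, map_add]
  rw [Submodule.projection_apply_of_mem_left _ hx, Submodule.projection_apply_of_mem_right _ hy,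
    Submodule.projection_apply_of_mem_left _ hy, Submodule.projection_apply_of_mem_right _ hx]
  simp [sub_eq_add_neg]

theorem orthogonal' (F : FundamentalDecomposition B) {x y : V} (hx : x ∈ F.neg)
    (hy : y ∈ F.pos) : B x y = 0 := by
  rw [← F.hermitian, F.orthogonal y hy x hx, map_zero]

/-- A Kreĭn space is a Hilbert space with the form `⟪j ·, ·⟫` of a symmetric involution `j`. -/
theorem exists_hilbert (F : FundamentalDecomposition B) :
    ∃ (E : Type u) (_ : NormedAddCommGroup E) (_ : InnerProductSpace ℂ E) (_ : CompleteSpace E)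
      (e : E ≃ₗ[ℂ] V) (j : E →L[ℂ] E), (∀ x y, ⟪j x, y⟫_ℂ = ⟪x, j y⟫_ℂ) ∧ (∀ x, j (j x) = x) ∧
      (∀ x y, B (e x) (e y) = ⟪j x, y⟫_ℂ) ∧ ∀ x, F.normSq (e x) = ‖x‖ ^ 2 := by
  obtain ⟨E₁, _, _, _, e₁, h₁⟩ := F.hilbert_pos.exists_equiv
  obtain ⟨E₂, _, _, _, e₂, h₂⟩ := F.hilbert_neg.exists_equiv
  have h₁' : ∀ x y, B (e₁ x) (e₁ y) = ⟪x, y⟫_ℂ := h₁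
  have h₂' : ∀ x y, B (e₂ x) (e₂ y) = -⟪x, y⟫_ℂ := fun x y => by
    rw [← h₂]
    exact (neg_neg _).symm
  let e : WithLp 2 (E₁ × E₂) ≃ₗ[ℂ] V := (WithLp.linearEquiv 2 ℂ (E₁ × E₂)).trans
    ((e₁.prodCongr e₂).trans (Submodule.prodEquivOfIsCompl F.pos F.neg F.isCompl))
  have he : ∀ x, e x = (e₁ x.fst : V) + (e₂ x.snd : V) := fun x => rfl
  let j₀ : WithLp 2 (E₁ × E₂) →ₗ[ℂ] WithLp 2 (E₁ × E₂) :=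
    { toFun := fun x => WithLp.toLp 2 (x.fst, -x.snd)
      map_add' := fun x y => by
        apply (WithLp.equiv 2 _).injective
        ext <;> simp [add_comm]
      map_smul' := fun c x => by
        apply (WithLp.equiv 2 _).injective
        ext <;> simp }
  have hj₀ : ∀ x, ‖j₀ x‖ ≤ 1 * ‖x‖ := fun x => by
    rw [one_mul, ← sq_le_sq₀ (norm_nonneg _) (norm_nonneg _), WithLp.prod_norm_sq_eq_of_L2,
      WithLp.prod_norm_sq_eq_of_L2]
    simp [j₀]
  let j : WithLp 2 (E₁ × E₂) →L[ℂ] WithLp 2 (E₁ × E₂) := j₀.mkContinuous 1 hj₀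
  have hj : ∀ x, j x = WithLp.toLp 2 (x.fst, -x.snd) := fun x => rfl
  have hjj : ∀ x, j (j x) = x := fun x => by
    apply (WithLp.equiv 2 _).injective
    ext <;> simp [hj]
  have hB : ∀ x y, B (e x) (e y) = ⟪j x, y⟫_ℂ := fun x y => by
    rw [he, he, hj, WithLp.prod_inner_apply]
    simp only [map_add, LinearMap.add_apply, h₁', h₂', inner_neg_left]
    rw [F.orthogonal _ (e₁ x.fst).2 _ (e₂ y.snd).2, F.orthogonal' (e₂ x.snd).2 (e₁ y.fst).2]
    simp
  refine ⟨_, inferInstance, inferInstance, inferInstance, e, j, fun x y => ?_, fun x => ?_, hB,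
    fun x => ?_⟩
  · simp [hj, WithLp.prod_inner_apply]
  · exact hjj x
  · have hJ : F.J (e x) = e (j x) := by
      rw [he, he, F.J_apply_of_mem (e₁ _).2 (e₂ _).2, hj]
      simp [sub_eq_add_neg]
    rw [normSq, hJ, hB, hjj]
    exact inner_self_eq_norm_sq (𝕜 := ℂ) x

/-- The form `⟪j ·, ·⟫` of a symmetric involution `j` of a Hilbert space is that of a Kreĭn space
with the topology of the Hilbert space. -/
theorem exists_of_equiv {E : Type*} [NormedAddCommGroup E] [InnerProductSpace ℂ E]
    [CompleteSpace E] (e : E ≃ₗ[ℂ] V) (j : E →L[ℂ] E) (hj : ∀ x y, ⟪j x, y⟫_ℂ = ⟪x, j y⟫_ℂ)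
    (hjj : ∀ x, j (j x) = x) (h : ∀ x y, B (e x) (e y) = ⟪j x, y⟫_ℂ) :
    ∃ F : FundamentalDecomposition B, ∀ x, F.normSq (e x) = ‖x‖ ^ 2 := by
  -- The fundamental decomposition is that into the eigenspaces of `j` for `1` and `-1`.
  let P : Submodule ℂ E := LinearMap.ker (j - 1 : E →L[ℂ] E).toLinearMap
  let N : Submodule ℂ E := LinearMap.ker (j + 1 : E →L[ℂ] E).toLinearMap
  have hP : ∀ x, x ∈ P ↔ j x = x := fun x => by
    simp [P, sub_eq_zero]
  have hN : ∀ x, x ∈ N ↔ j x = -x := fun x => by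
    simp [N, add_eq_zero_iff_eq_neg]
  have hPc : CompleteSpace P := by
    have : IsClosed (P : Set E) := (j - 1 : E →L[ℂ] E).isClosed_ker
    exact this.completeSpace_coe
  have hNc : CompleteSpace N := by
    have : IsClosed (N : Set E) := (j + 1 : E →L[ℂ] E).isClosed_ker
    exact this.completeSpace_coe
  have hPN : IsCompl P N := by
    rw [isCompl_iff, Submodule.disjoint_def, codisjoint_iff, Submodule.eq_top_iff']
    refine ⟨fun x hx hx' => ?_, fun x => ?_⟩
    · rw [hP] at hx
      rw [hN, hx] at hx'
      have h2 := add_eq_zero_iff_eq_neg.2 hx'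
      rw [← two_smul ℂ] at h2
      simpa using h2
    · refine Submodule.mem_sup.2 ⟨(2⁻¹ : ℂ) • (x + j x), ?_, (2⁻¹ : ℂ) • (x - j x), ?_, ?_⟩
      · rw [hP, map_smul, map_add, hjj, add_comm]
      · rw [hN, map_smul, map_sub, hjj, ← smul_neg, neg_sub]
      · rw [← smul_add, add_add_sub_cancel, ← two_smul ℂ, smul_smul]
        norm_num
  let F : FundamentalDecomposition B :=
    { pos := P.map e.toLinearMap
      neg := N.map e.toLinearMap
      hermitian := fun x y => by
        obtain ⟨x, rfl⟩ := e.surjective x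
        obtain ⟨y, rfl⟩ := e.surjective y
        rw [h, h, inner_conj_symm, hj]
      isCompl := by
        have := hPN.map (Submodule.orderIsoMapComap e)
        exact this
      orthogonal := by
        rintro _ ⟨x, hx, rfl⟩ _ ⟨y, hy, rfl⟩
        have h1 := hj x y
        rw [(hP x).1 hx, (hN y).1 hy, inner_neg_right] at h1
        refine (h x y).trans ?_
        rw [(hP x).1 hx]
        exact self_eq_neg.1 h1
      hilbert_pos := by
        refine isHilbertSpace_of_equiv (e.submoduleMap P) fun x y => ?_
        refine (h x y).trans ?_
        rw [(hP x).1 x.2]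
        rfl
      hilbert_neg := by
        refine isHilbertSpace_of_equiv (e.submoduleMap N) fun x y => ?_
        refine (congrArg Neg.neg (h x y)).trans ?_
        rw [(hN x).1 x.2, inner_neg_left, neg_neg]
        rfl }
  have hJ : ∀ x, F.J (e x) = e (j x) := fun x => by
    have hx : x ∈ P ⊔ N := by rw [hPN.sup_eq_top]; trivial
    obtain ⟨y, hy, z, hz, rfl⟩ := Submodule.mem_sup.1 hx
    have := F.J_apply_of_mem (x := e y) (y := e z) (Submodule.mem_map_of_mem hy)
      (Submodule.mem_map_of_mem hz)
    rw [map_add e, this, map_add j, (hP y).1 hy, (hN z).1 hz, ← sub_eq_add_neg, map_sub]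
  refine ⟨F, fun x => ?_⟩
  rw [normSq, hJ, h, hjj]
  exact inner_self_eq_norm_sq (𝕜 := ℂ) x

end FundamentalDecomposition

end Krein

/-! ### Completions from factorizations of the inverse -/

section OperatorRange

variable {H : Type u} [NormedAddCommGroup H] [InnerProductSpace ℂ H]
variable {E : Type*} [NormedAddCommGroup E] [InnerProductSpace ℂ E]

/-- The range of an injective operator `D`, with the form `(D x, D y) ↦ ⟪j x, y⟫`. -/
noncomputable def rangeFormSubspace (D : E →L[ℂ] H) (hD : Function.Injective D) (j : E →L[ℂ] E) :
    FormSubspace H where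
  space := LinearMap.range D.toLinearMap
  form := LinearMap.mk₂'ₛₗ (starRingEnd ℂ) (RingHom.id ℂ)
    (fun x y => ⟪j ((LinearEquiv.ofInjective D.toLinearMap hD).symm x),
      (LinearEquiv.ofInjective D.toLinearMap hD).symm y⟫_ℂ)
    (fun _ _ _ => by simp only [map_add, inner_add_left])
    (fun _ _ _ => by simp only [map_smul, inner_smul_left, smul_eq_mul])
    (fun _ _ _ => by simp only [map_add, inner_add_right])
    (fun _ _ _ => by simp only [map_smul, inner_smul_right, smul_eq_mul, RingHom.id_apply])

/-- The operator `D`, as a bijection onto its range. -/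
noncomputable def rangeEquiv (D : E →L[ℂ] H) (hD : Function.Injective D) (j : E →L[ℂ] E) :
    E ≃ₗ[ℂ] (rangeFormSubspace D hD j).space :=
  LinearEquiv.ofInjective D.toLinearMap hD

theorem coe_rangeEquiv_apply (D : E →L[ℂ] H) (hD : Function.Injective D) (j : E →L[ℂ] E) (x : E) :
    (rangeEquiv D hD j x : H) = D x :=
  rfl

theorem rangeFormSubspace_form_apply (D : E →L[ℂ] H) (hD : Function.Injective D) (j : E →L[ℂ] E)
    (x y : E) :
    (rangeFormSubspace D hD j).form (rangeEquiv D hD j x) (rangeEquiv D hD j y) = ⟪j x, y⟫_ℂ := by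
  change ⟪j ((LinearEquiv.ofInjective D.toLinearMap hD).symm (LinearEquiv.ofInjective _ hD x)),
    (LinearEquiv.ofInjective D.toLinearMap hD).symm (LinearEquiv.ofInjective _ hD y)⟫_ℂ = _
  rw [LinearEquiv.symm_apply_apply, LinearEquiv.symm_apply_apply]

/-- The orthogonal complement of the range of `D*` is the kernel of `D`. For `S = D j D*` this is
what makes `dom T = D j D* H` dense in the range of `D`. -/
theorem denseRange_adjoint_of_injective [CompleteSpace H] [CompleteSpace E] (D : E →L[ℂ] H)
    (hD : Function.Injective D) : DenseRange (ContinuousLinearMap.adjoint D) := by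
  have h1 : (LinearMap.range (ContinuousLinearMap.adjoint D).toLinearMap).topologicalClosure
      = ⊤ := by
    rw [Submodule.topologicalClosure_eq_top_iff, Submodule.eq_bot_iff]
    intro x hx
    apply hD
    rw [map_zero, ← inner_self_eq_zero (𝕜 := ℂ), ← ContinuousLinearMap.adjoint_inner_left]
    exact hx _ ⟨_, rfl⟩
  exact Submodule.dense_iff_topologicalClosure_eq_top.2 h1

variable [CompleteSpace H] [CompleteSpace E]

/-- A factorization `T⁻¹ = D j D*` yields a Kreĭn space completion. -/
theorem rangeFormSubspace_mem_completions {T : H →ₗ.[ℂ] H} (hT : IsSelfAdjoint T) {S : H →L[ℂ] H}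
    (hST : ∀ x : T.domain, S (T x) = x) (hTS : ∀ y : H, ∃ h : S y ∈ T.domain, T ⟨S y, h⟩ = y)
    (D : E →L[ℂ] H) (hD : Function.Injective D) (j : E →L[ℂ] E)
    (hj : ∀ x y, ⟪j x, y⟫_ℂ = ⟪x, j y⟫_ℂ) (hjj : ∀ x, j (j x) = x)
    (hS : ∀ y, S y = D (j (ContinuousLinearMap.adjoint D y))) :
    rangeFormSubspace D hD j ∈ completions T hT := by
  let e := rangeEquiv D hD j
  have he : ∀ x, (e x : H) = D x := coe_rangeEquiv_apply D hD j
  have hform : ∀ x y, (rangeFormSubspace D hD j).form (e x) (e y) = ⟪j x, y⟫_ℂ :=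
    rangeFormSubspace_form_apply D hD j
  have hdom : ∀ x : T.domain, (x : H) = D (j (ContinuousLinearMap.adjoint D (T x))) := fun x => by
    rw [← hS, hST]
  refine ⟨⟨fun x hx => ⟨_, (hdom ⟨x, hx⟩).symm⟩, fun x y => ?_⟩, ?_⟩
  · have key : ∀ h : T.domain ≤ (rangeFormSubspace D hD j).space, ∀ z : T.domain,
        Submodule.inclusion h z = e (j (ContinuousLinearMap.adjoint D (T z))) :=
      fun h z => Subtype.ext (hdom z)
    refine (congrArg₂ (fun a b => (rangeFormSubspace D hD j).form a b)
      (key _ x) (key _ y)).trans ?_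
    refine (hform _ _).trans ?_
    rw [hjj, ContinuousLinearMap.adjoint_inner_left, ← hdom y]
    rfl
  · obtain ⟨F, hF⟩ := FundamentalDecomposition.exists_of_equiv
      (B := (rangeFormSubspace D hD j).form) e j hj hjj hform
    refine ⟨F, ⟨‖D‖ ^ 2, fun x => ?_⟩, fun x ε hε => ?_⟩
    · obtain ⟨x, rfl⟩ := e.surjective x
      rw [hF, he, ← mul_pow]
      gcongr
      exact D.le_opNorm x
    · obtain ⟨x, rfl⟩ := e.surjective x
      -- Vectors over `dom T` have the form `j (D* y)`, so `j x` is approximated and `j` applied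
      -- again; the `+ 1` avoids a division by zero.
      obtain ⟨y, hy⟩ := (denseRange_adjoint_of_injective D hD).exists_dist_lt (j x)
        (ε := √ε / (‖j‖ + 1)) (by positivity)
      refine ⟨e (j (ContinuousLinearMap.adjoint D y)), ?_, ?_⟩
      · change D (j (ContinuousLinearMap.adjoint D y)) ∈ T.domain
        rw [← hS]
        exact (hTS y).1
      · have h1 : x - j (ContinuousLinearMap.adjoint D y)
            = j (j x - ContinuousLinearMap.adjoint D y) := by rw [map_sub, hjj]
        rw [dist_eq_norm, lt_div_iff₀ (by positivity)] at hy
        rw [← map_sub, hF, h1, ← Real.lt_sqrt (norm_nonneg _)]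
        refine lt_of_le_of_lt ((j.le_opNorm _).trans ?_) hy
        rw [mul_comm]
        gcongr
        linarith

end OperatorRange

/-! ### Completions, closures and range restrictions -/

section Correspondence

variable {H : Type u} [NormedAddCommGroup H] [InnerProductSpace ℂ H] [CompleteSpace H]
variable {T : H →ₗ.[ℂ] H} {hT : IsSelfAdjoint T}

/-- A Kreĭn space completion, as a form in `H`. -/
def FormSubspace.toSymForm (k : FormSubspace H) (hk : k ∈ completions T hT) : SymForm H where
  domain := k.space
  form := k.form
  dense := hT.dense_domain.mono hk.1.1
  symm := hk.2.choose.hermitian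

theorem SymForm.shift_zero {H : Type u} [NormedAddCommGroup H] [InnerProductSpace ℂ H]
    (t : SymForm H) : t.shift 0 = t.form := by
  simp [SymForm.shift]

/-- The shift by zero changes nothing, so a completion is a closure with gap point zero. -/
theorem FormSubspace.toSymForm_mem_closures (k : FormSubspace H) (hk : k ∈ completions T hT) :
    k.toSymForm hk ∈ closures T hT := by
  have h : ∃ F : FundamentalDecomposition ((k.toSymForm hk).shift 0),
      F.EmbedsContinuously ∧ F.IsDense {x : k.space | (x : H) ∈ T.domain} := by
    rw [SymForm.shift_zero]
    exact hk.2
  obtain ⟨F, hF, hF'⟩ := h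
  exact ⟨⟨0, F, hF⟩, hk.1, 0, F, hF, hF'⟩

theorem FormSubspace.toSymForm_inj {k l : FormSubspace H} (hk : k ∈ completions T hT)
    (hl : l ∈ completions T hT) (h : k.toSymForm hk = l.toSymForm hl) : k = l := by
  obtain ⟨K, B⟩ := k
  obtain ⟨L, C⟩ := l
  simp only [FormSubspace.toSymForm, SymForm.mk.injEq] at h
  obtain ⟨rfl, h⟩ := h
  rw [eq_of_heq h]

/-- The range restriction of `T` to `K`. -/
def rangeRestriction {H : Type u} [NormedAddCommGroup H] [InnerProductSpace ℂ H]
    (T : H →ₗ.[ℂ] H) (K : Submodule ℂ H) : K →ₗ.[ℂ] K where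
  domain :=
    { carrier := {x | ∃ h : (x : H) ∈ T.domain, T ⟨x, h⟩ ∈ K}
      add_mem' := by
        rintro x y ⟨hx, hx'⟩ ⟨hy, hy'⟩
        refine ⟨T.domain.add_mem hx hy, ?_⟩
        have := K.add_mem hx' hy'
        rwa [← T.map_add] at this
      zero_mem' := ⟨T.domain.zero_mem, by
        have := K.zero_mem
        rwa [← T.map_zero] at this⟩
      smul_mem' := by
        rintro c x ⟨hx, hx'⟩
        refine ⟨T.domain.smul_mem c hx, ?_⟩
        have := K.smul_mem c hx'
        rwa [← T.map_smul] at this }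
  toFun :=
    { toFun := fun x => ⟨T ⟨x, x.2.1⟩, x.2.2⟩
      map_add' := fun x y => Subtype.ext (T.map_add ⟨x, x.2.1⟩ ⟨y, y.2.1⟩)
      map_smul' := fun c x => Subtype.ext (T.map_smul c ⟨x, x.2.1⟩) }

theorem isRangeRestriction_iff {H : Type u} [NormedAddCommGroup H] [InnerProductSpace ℂ H]
    {T : H →ₗ.[ℂ] H} {K : Submodule ℂ H} {A : K →ₗ.[ℂ] K} :
    IsRangeRestriction T A ↔ A = rangeRestriction T K := by
  constructor
  · rintro ⟨h1, h2⟩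
    refine LinearPMap.ext (Submodule.ext h1) fun x hx hx' => ?_
    exact Subtype.ext (h2 ⟨x, hx⟩ hx'.1)
  · rintro rfl
    exact ⟨fun x => Iff.rfl, fun x h => rfl⟩

/-- Each space carries exactly one range restriction of `T`, so forgetting the operator loses
nothing. -/
theorem existsUnique_completionsOp_iff :
    (∃! k, k ∈ completionsOp T hT) ↔ ∃! k, k ∈ completions T hT := by
  constructor
  · rintro ⟨k, hk, hk'⟩
    refine ⟨k.toFormSubspace, hk.1, fun l hl => ?_⟩
    have := hk' ⟨l, rangeRestriction T l.space⟩ ⟨hl, isRangeRestriction_iff.2 rfl⟩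
    rw [← this]
  · rintro ⟨k, hk, hk'⟩
    refine ⟨⟨k, rangeRestriction T k.space⟩, ⟨hk, isRangeRestriction_iff.2 rfl⟩, ?_⟩
    rintro ⟨l, A⟩ ⟨hl, hA⟩
    obtain rfl := hk' l hl
    exact congrArg _ (isRangeRestriction_iff.1 hA)

end Correspondence

/-! ### Uniqueness of the closure for semibounded operators -/

section Semibounded

/-- A positive operator that is onto is uniformly positive. -/
theorem exists_norm_sq_le_of_surjective {E : Type*} [NormedAddCommGroup E] [InnerProductSpace ℂ E]
    [CompleteSpace E] (G : E →L[ℂ] E) (hG : ∀ x y, ⟪G x, y⟫_ℂ = ⟪x, G y⟫_ℂ)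
    (hpos : ∀ x, 0 ≤ (⟪G x, x⟫_ℂ).re) (hsurj : Function.Surjective G) :
    ∃ C : ℝ, ∀ x, ‖x‖ ^ 2 ≤ C * (⟪G x, x⟫_ℂ).re := by
  obtain ⟨C, hC, h⟩ := G.exists_preimage_norm_le hsurj
  refine ⟨C, fun x => ?_⟩
  obtain ⟨y, hy, hyC⟩ := h x
  have hxx : (⟪x, x⟫_ℂ).re = ‖x‖ ^ 2 := inner_self_eq_norm_sq (𝕜 := ℂ) x
  -- Positivity at `x - r • y`, where `G y = x`, bounds `⟪G x, x⟫` below by `(2 r - C r²) ‖x‖²`; the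
  -- best choice is `r = C⁻¹`.
  have h1 : (⟪G (x - ((C⁻¹ : ℝ) : ℂ) • y), x - ((C⁻¹ : ℝ) : ℂ) • y⟫_ℂ).re
      = (⟪G x, x⟫_ℂ).re - 2 * C⁻¹ * ‖x‖ ^ 2 + C⁻¹ * (C⁻¹ * (⟪x, y⟫_ℂ).re) := by
    rw [map_sub, map_smul, hy]
    simp only [inner_sub_left, inner_sub_right, inner_smul_left, inner_smul_right,
      Complex.conj_ofReal, Complex.sub_re, Complex.re_ofReal_mul]
    rw [hG x y, hy, hxx]
    ring
  have h2 : (⟪x, y⟫_ℂ).re ≤ C * ‖x‖ ^ 2 := by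
    calc (⟪x, y⟫_ℂ).re ≤ ‖x‖ * ‖y‖ := re_inner_le_norm (𝕜 := ℂ) x y
      _ ≤ ‖x‖ * (C * ‖x‖) := by gcongr
      _ = _ := by ring
  have h3 := hpos (x - ((C⁻¹ : ℝ) : ℂ) • y)
  rw [h1] at h3
  have h4 : C⁻¹ * (C⁻¹ * (⟪x, y⟫_ℂ).re) ≤ C⁻¹ * ‖x‖ ^ 2 := by
    gcongr
    rwa [inv_mul_le_iff₀ hC]
  have h5 : C⁻¹ * ‖x‖ ^ 2 ≤ (⟪G x, x⟫_ℂ).re := by linarith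
  rwa [inv_mul_le_iff₀ hC] at h5

variable {H : Type u} [NormedAddCommGroup H] [InnerProductSpace ℂ H] [CompleteSpace H]

theorem inner_apply_left_of_isSelfAdjoint {T : H →ₗ.[ℂ] H} (hT : IsSelfAdjoint T)
    (x y : T.domain) : ⟪T x, (y : H)⟫_ℂ = ⟪(x : H), T y⟫_ℂ := by
  have h := LinearPMap.adjoint_isFormalAdjoint (T := T) hT.dense_domain
  rw [LinearPMap.isSelfAdjoint_def.mp hT] at h
  exact h x y

theorem inner_inverse_left {T : H →ₗ.[ℂ] H} (hT : IsSelfAdjoint T) {S : H →L[ℂ] H}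
    (hTS : ∀ y : H, ∃ h : S y ∈ T.domain, T ⟨S y, h⟩ = y) (x y : H) :
    ⟪S x, y⟫_ℂ = ⟪x, S y⟫_ℂ := by
  obtain ⟨hx, hx'⟩ := hTS x
  obtain ⟨hy, hy'⟩ := hTS y
  have := inner_apply_left_of_isSelfAdjoint hT ⟨S x, hx⟩ ⟨S y, hy⟩
  rw [hx', hy'] at this
  exact this.symm

/-- `T - m` is onto if it is bounded from below in norm. -/
theorem surjective_sub_smul {T : H →ₗ.[ℂ] H} (hT : IsSelfAdjoint T)
    (hinv : BoundedlyInvertible T) (m : ℝ)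
    (hm : ∀ x : T.domain, ‖(x : H)‖ ≤ ‖T x - (m : ℂ) • (x : H)‖) (g : H) :
    ∃ x : T.domain, T x - (m : ℂ) • (x : H) = g := by
  obtain ⟨S, hST, hTS⟩ := hinv
  -- `U = (T - m) S` is bounded and symmetric, and it is onto exactly when `T - m` is.
  let U : H →L[ℂ] H := 1 - (m : ℂ) • S
  have hU : ∀ x, U x = x - (m : ℂ) • S x := fun x => rfl
  have hUs : ∀ x y, ⟪U x, y⟫_ℂ = ⟪x, U y⟫_ℂ := fun x y => by
    rw [hU, hU, inner_sub_left, inner_sub_right, inner_smul_left, inner_smul_right,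
      inner_inverse_left hT hTS, Complex.conj_ofReal]
  have hbound : ∀ x, ‖x‖ ≤ (1 + |m|) * ‖U x‖ := fun x => by
    obtain ⟨h, h'⟩ := hTS x
    have h1 := hm ⟨S x, h⟩
    rw [h'] at h1
    change ‖S x‖ ≤ ‖U x‖ at h1
    calc ‖x‖ = ‖U x + (m : ℂ) • S x‖ := by rw [hU, sub_add_cancel]
      _ ≤ ‖U x‖ + |m| * ‖S x‖ := (norm_add_le _ _).trans (by simp [norm_smul])
      _ ≤ ‖U x‖ + |m| * ‖U x‖ := by gcongr
      _ = _ := by ring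
  have hanti : AntilipschitzWith ⟨1 + |m|, by positivity⟩ U :=
    U.antilipschitz_of_bound hbound
  have hclosed : IsClosed (LinearMap.range U.toLinearMap : Set H) :=
    hanti.isClosed_range U.uniformContinuous
  -- The range is closed, and its orthogonal complement is the kernel of the symmetric operator `U`,
  -- which is zero.
  have htop : LinearMap.range U.toLinearMap = ⊤ := by
    have : CompleteSpace (LinearMap.range U.toLinearMap) := hclosed.completeSpace_coe
    rw [← Submodule.orthogonal_eq_bot_iff, Submodule.eq_bot_iff]
    intro x hx
    apply hanti.injective
    rw [map_zero, ← inner_self_eq_zero (𝕜 := ℂ), hUs, ← inner_conj_symm]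
    have h0 : ⟪U (U x), x⟫_ℂ = 0 := hx _ ⟨_, rfl⟩
    rw [h0, map_zero]
  obtain ⟨y, rfl⟩ := LinearMap.range_eq_top.1 htop g
  obtain ⟨h, h'⟩ := hTS y
  exact ⟨⟨S y, h⟩, by rw [h']; rfl⟩

/-- A semibounded operator is semidefinite, and onto, after some shift. -/
theorem Semibounded.exists_shift {T : H →ₗ.[ℂ] H} (h : Semibounded T) (hT : IsSelfAdjoint T)
    (hinv : BoundedlyInvertible T) :
    ∃ m : ℝ, (∀ g, ∃ x : T.domain, T x - (m : ℂ) • (x : H) = g) ∧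
      ((∀ x : T.domain, 0 ≤ (⟪T x, (x : H)⟫_ℂ).re - m * ‖(x : H)‖ ^ 2) ∨
        ∀ x : T.domain, (⟪T x, (x : H)⟫_ℂ).re - m * ‖(x : H)‖ ^ 2 ≤ 0) := by
  have key : ∀ (m : ℝ) (x : T.domain),
      ‖(x : H)‖ ^ 2 ≤ |(⟪T x, (x : H)⟫_ℂ).re - m * ‖(x : H)‖ ^ 2| →
        ‖(x : H)‖ ≤ ‖T x - (m : ℂ) • (x : H)‖ := fun m x hx => by
    have h1 : (⟪T x, (x : H)⟫_ℂ).re - m * ‖(x : H)‖ ^ 2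
        = (⟪T x - (m : ℂ) • (x : H), (x : H)⟫_ℂ).re := by
      rw [inner_sub_left, inner_smul_left, inner_self_eq_norm_sq_to_K, Complex.conj_ofReal,
        Complex.sub_re, Complex.re_ofReal_mul]
      norm_cast
    rw [h1] at hx
    have h2 := hx.trans ((Complex.abs_re_le_norm _).trans (norm_inner_le_norm _ _))
    rcases (norm_nonneg (x : H)).eq_or_lt with h0 | h0
    · rw [← h0]
      positivity
    · rw [sq] at h2
      exact le_of_mul_le_mul_right h2 h0
  obtain ⟨c, hc | hc⟩ := h
  -- Moving one unit beyond the bound `c` gives `T - m` the lower norm bound that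
  -- `surjective_sub_smul` needs.
  · have h1 : ∀ x : T.domain, ‖(x : H)‖ ^ 2 ≤ (⟪T x, (x : H)⟫_ℂ).re - (c - 1) * ‖(x : H)‖ ^ 2 :=
      fun x => by linarith [hc x]
    exact ⟨c - 1, surjective_sub_smul hT hinv _ fun x => key _ x ((h1 x).trans (le_abs_self _)),
      Or.inl fun x => (sq_nonneg _).trans (h1 x)⟩
  · have h1 : ∀ x : T.domain, ‖(x : H)‖ ^ 2 ≤ -((⟪T x, (x : H)⟫_ℂ).re - (c + 1) * ‖(x : H)‖ ^ 2) :=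
      fun x => by linarith [hc x]
    exact ⟨c + 1, surjective_sub_smul hT hinv _ fun x => key _ x ((h1 x).trans (neg_le_abs _)),
      Or.inr fun x => neg_nonneg.1 ((sq_nonneg _).trans (h1 x))⟩

/-- In a closure of a semidefinite form (up to a shift), the norm of the Kreĭn space is bounded by
the form. -/
theorem exists_norm_sq_le_form {T : H →ₗ.[ℂ] H} {m : ℝ}
    (hsurj : ∀ g, ∃ x : T.domain, T x - (m : ℂ) • (x : H) = g)
    (hpos : (∀ x : T.domain, 0 ≤ (⟪T x, (x : H)⟫_ℂ).re - m * ‖(x : H)‖ ^ 2) ∨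
        ∀ x : T.domain, (⟪T x, (x : H)⟫_ℂ).re - m * ‖(x : H)‖ ^ 2 ≤ 0)
    {E : Type*} [NormedAddCommGroup E] [InnerProductSpace ℂ E] [CompleteSpace E]
    (D : E →L[ℂ] H) (j : E →L[ℂ] E) (l : ℝ) (hj : ∀ x y, ⟪j x, y⟫_ℂ = ⟪x, j y⟫_ℂ)
    (hjj : ∀ x, j (j x) = x) (hrange : ∀ x ∈ T.domain, ∃ y, D y = x)
    (hdense : Dense {x | D x ∈ T.domain})
    (hform : ∀ (x y : E) (hx : D x ∈ T.domain), D y ∈ T.domain →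
      ⟪T ⟨D x, hx⟩, D y⟫_ℂ = ⟪j x, y⟫_ℂ + l * ⟪D x, D y⟫_ℂ) :
    ∃ C : ℝ, ∀ (x : E) (hx : D x ∈ T.domain),
      ‖x‖ ^ 2 ≤ C * |(⟪T ⟨D x, hx⟩, D x⟫_ℂ).re - m * ‖D x‖ ^ 2| := by
  -- `G` represents the form shifted by `m`: the involution accounts for the shift by `l`, and `D*
  -- D` for the inner product of `H`.
  let G : E →L[ℂ] E := j + ((l - m : ℝ) : ℂ) • (ContinuousLinearMap.adjoint D).comp D
  have hG : ∀ x, G x = j x + ((l - m : ℝ) : ℂ) • ContinuousLinearMap.adjoint D (D x) :=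
    fun x => rfl
  have hGs : ∀ x y, ⟪G x, y⟫_ℂ = ⟪x, G y⟫_ℂ := fun x y => by
    rw [hG, hG, inner_add_left, inner_add_right, inner_smul_left, inner_smul_right,
      ContinuousLinearMap.adjoint_inner_left, ContinuousLinearMap.adjoint_inner_right, hj,
      Complex.conj_ofReal]
  have hGT : ∀ (x : E) (hx : D x ∈ T.domain),
      (⟪T ⟨D x, hx⟩, D x⟫_ℂ).re - m * ‖D x‖ ^ 2 = (⟪G x, x⟫_ℂ).re := fun x hx => by
    rw [hform x x hx hx, hG, inner_add_left, inner_smul_left,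
      ContinuousLinearMap.adjoint_inner_left, Complex.conj_ofReal, Complex.add_re, Complex.add_re,
      Complex.re_ofReal_mul, Complex.re_ofReal_mul]
    have : (⟪D x, D x⟫_ℂ).re = ‖D x‖ ^ 2 := inner_self_eq_norm_sq (𝕜 := ℂ) (D x)
    rw [this]
    ring
  have hrep : ∀ (x : E) (hx : D x ∈ T.domain),
      ContinuousLinearMap.adjoint D (T ⟨D x, hx⟩ - (l : ℂ) • D x) = j x := fun x hx => by
    refine ext_inner_right ℂ fun y => ?_
    refine hdense.induction (P := fun y => ⟪ContinuousLinearMap.adjoint D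
      (T ⟨D x, hx⟩ - (l : ℂ) • D x), y⟫_ℂ = ⟪j x, y⟫_ℂ) (fun y hy => ?_)
      (isClosed_eq (by fun_prop) (by fun_prop)) y
    rw [ContinuousLinearMap.adjoint_inner_left, inner_sub_left, hform x y hx hy, inner_smul_left,
      Complex.conj_ofReal, add_sub_cancel_right]
  -- `G (j x) = x + (l - m) D* D (j x)`, and `G k = D* ((T - m) D k)` when `D k` lies in `dom T`.
  -- Solving `(T - m) D k = (m - l) D (j x)` cancels the extra term.
  have hsurjG : Function.Surjective G := fun x => by
    obtain ⟨f, hf⟩ := hsurj (((m - l : ℝ) : ℂ) • D (j x))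
    obtain ⟨f, hfT⟩ := f
    obtain ⟨k, rfl⟩ := hrange f hfT
    have h1 := hrep k hfT
    rw [sub_eq_iff_eq_add.1 hf] at h1
    refine ⟨j x + k, ?_⟩
    rw [map_add, hG, hG, hjj, ← h1]
    simp only [map_add, map_sub, map_smul]
    push_cast
    module
  have hcont : Continuous fun x => (⟪G x, x⟫_ℂ).re := by fun_prop
  rcases hpos with hpos | hpos
  · have hpos' : ∀ x, 0 ≤ (⟪G x, x⟫_ℂ).re := fun x =>
      hdense.induction (P := fun x => 0 ≤ (⟪G x, x⟫_ℂ).re)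
        (fun x hx => hGT x hx ▸ hpos ⟨D x, hx⟩) (isClosed_le continuous_const hcont) x
    obtain ⟨C, hC⟩ := exists_norm_sq_le_of_surjective G hGs hpos' hsurjG
    refine ⟨C, fun x hx => ?_⟩
    rw [hGT x hx, abs_of_nonneg (hpos' x)]
    exact hC x
  · have hpos' : ∀ x, (⟪G x, x⟫_ℂ).re ≤ 0 := fun x =>
      hdense.induction (P := fun x => (⟪G x, x⟫_ℂ).re ≤ 0)
        (fun x hx => hGT x hx ▸ hpos ⟨D x, hx⟩) (isClosed_le hcont continuous_const) x
    obtain ⟨C, hC⟩ := exists_norm_sq_le_of_surjective (-G)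
      (fun x y => by simp [hGs]) (fun x => by simpa using hpos' x)
      (fun x => by
        obtain ⟨y, hy⟩ := hsurjG (-x)
        exact ⟨y, by simp [hy]⟩)
    refine ⟨C, fun x hx => ?_⟩
    rw [hGT x hx, abs_of_nonpos (hpos' x)]
    simpa using hC x

/-- A closure of `(T·,·)` is the range of an operator `D` on a Hilbert space, with the form of a
symmetric involution up to a shift. -/
theorem exists_hilbert_of_mem_closures {T : H →ₗ.[ℂ] H} {hT : IsSelfAdjoint T} {t : SymForm H}
    (ht : t ∈ closures T hT) :
    ∃ (l : ℝ) (E : Type u) (_ : NormedAddCommGroup E) (_ : InnerProductSpace ℂ E)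
      (_ : CompleteSpace E) (e : E ≃ₗ[ℂ] t.domain) (D : E →L[ℂ] H) (j : E →L[ℂ] E),
      (∀ x, (e x : H) = D x) ∧ (∀ x y, ⟪j x, y⟫_ℂ = ⟪x, j y⟫_ℂ) ∧ (∀ x, j (j x) = x) ∧
      (∀ x y, t.form (e x) (e y) = ⟪j x, y⟫_ℂ + l * ⟪D x, D y⟫_ℂ) ∧
      (∀ x ∈ T.domain, ∃ y, D y = x) ∧ Dense {x | D x ∈ T.domain} ∧
      ∀ (x y : E) (hx : D x ∈ T.domain), D y ∈ T.domain →
        ⟪T ⟨D x, hx⟩, D y⟫_ℂ = t.form (e x) (e y) := by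
  obtain ⟨-, ⟨hdom, hext⟩, l, F, ⟨C, hC⟩, hdense⟩ := ht
  obtain ⟨E, _, _, _, e, j, hj, hjj, hB, hnorm⟩ := F.exists_hilbert
  let D : E →L[ℂ] H := (t.domain.subtype ∘ₗ e.toLinearMap).mkContinuous (√C) fun x => by
    have h1 := hC (e x)
    rw [hnorm] at h1
    have h2 := Real.le_sqrt_of_sq_le h1
    rwa [Real.sqrt_mul' _ (sq_nonneg _), Real.sqrt_sq (norm_nonneg _)] at h2
  have he : ∀ x, (e x : H) = D x := fun x => rfl
  refine ⟨l, E, inferInstance, inferInstance, inferInstance, e, D, j, he, hj, hjj, fun x y => ?_,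
    fun x hx => ?_, fun x => ?_, fun x y hx hy => ?_⟩
  · rw [← hB]
    exact (sub_add_cancel _ _).symm
  · exact ⟨e.symm ⟨x, hdom hx⟩, by rw [← he, e.apply_symm_apply]⟩
  · rw [Metric.mem_closure_iff]
    intro ε hε
    obtain ⟨y, hy, hxy⟩ := hdense (e x) (ε ^ 2) (by positivity)
    obtain ⟨y, rfl⟩ := e.surjective y
    refine ⟨y, hy, ?_⟩
    rw [← map_sub, hnorm] at hxy
    rw [dist_eq_norm]
    exact lt_of_pow_lt_pow_left₀ 2 hε.le hxy
  · exact (hext ⟨D x, hx⟩ ⟨D y, hy⟩).symm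

/-- Closures of `(T·,·)` extend one another if `T` is semibounded. -/
theorem isExtension_of_semibounded {T : H →ₗ.[ℂ] H} {hT : IsSelfAdjoint T}
    (hinv : BoundedlyInvertible T) (hsemi : Semibounded T) {s t : SymForm H}
    (hs : s ∈ closures T hT) (ht : t ∈ closures T hT) : SymForm.IsExtension s t := by
  obtain ⟨m, hsurj, hpos⟩ := hsemi.exists_shift hT hinv
  obtain ⟨l₁, E₁, _, _, _, e₁, D₁, j₁, he₁, hj₁, hjj₁, hf₁, hr₁, hd₁, hT₁⟩ :=
    exists_hilbert_of_mem_closures hs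
  obtain ⟨l₂, E₂, _, _, _, e₂, D₂, j₂, he₂, hj₂, hjj₂, hf₂, hr₂, hd₂, hT₂⟩ :=
    exists_hilbert_of_mem_closures ht
  obtain ⟨C, hC⟩ := exists_norm_sq_le_form hsurj hpos D₂ j₂ l₂ hj₂ hjj₂ hr₂ hd₂
    fun x y hx hy => by rw [hT₂ x y hx hy, hf₂]
  have hC' : ∀ (x : E₂) (hx : D₂ x ∈ T.domain),
      ‖x‖ ^ 2 ≤ |C| * |(⟪T ⟨D₂ x, hx⟩, D₂ x⟫_ℂ).re - m * ‖D₂ x‖ ^ 2| := fun x hx =>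
    (hC x hx).trans (by gcongr; exact le_abs_self C)
  have hub : ∀ (x : E₁) (hx : D₁ x ∈ T.domain),
      |(⟪T ⟨D₁ x, hx⟩, D₁ x⟫_ℂ).re - m * ‖D₁ x‖ ^ 2|
        ≤ (‖j₁‖ + |l₁ - m| * ‖D₁‖ ^ 2) * ‖x‖ ^ 2 := fun x hx => by
    have h1 : (⟪T ⟨D₁ x, hx⟩, D₁ x⟫_ℂ).re - m * ‖D₁ x‖ ^ 2
        = (⟪j₁ x, x⟫_ℂ).re + (l₁ - m) * ‖D₁ x‖ ^ 2 := by
      rw [hT₁ x x hx hx, hf₁, Complex.add_re, Complex.re_ofReal_mul]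
      have : (⟪D₁ x, D₁ x⟫_ℂ).re = ‖D₁ x‖ ^ 2 := inner_self_eq_norm_sq (𝕜 := ℂ) (D₁ x)
      rw [this]
      ring
    rw [h1]
    calc |(⟪j₁ x, x⟫_ℂ).re + (l₁ - m) * ‖D₁ x‖ ^ 2|
        ≤ |(⟪j₁ x, x⟫_ℂ).re| + |(l₁ - m) * ‖D₁ x‖ ^ 2| := abs_add_le _ _
      _ ≤ ‖j₁ x‖ * ‖x‖ + |l₁ - m| * ‖D₁ x‖ ^ 2 := by
          rw [abs_mul, abs_of_nonneg (sq_nonneg ‖D₁ x‖)]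
          gcongr
          exact (Complex.abs_re_le_norm _).trans (norm_inner_le_norm _ _)
      _ ≤ (‖j₁‖ * ‖x‖) * ‖x‖ + |l₁ - m| * (‖D₁‖ * ‖x‖) ^ 2 := by
          gcongr
          · exact j₁.le_opNorm x
          · exact D₁.le_opNorm x
      _ = _ := by ring
  -- `M` is the copy of `dom T` in `E₁`, and `f` below identifies it with the copy in `E₂`.
  let M : Submodule ℂ E₁ := T.domain.comap D₁.toLinearMap
  have hM : DenseRange M.subtype := by
    rw [DenseRange, Submodule.coe_subtype, Subtype.range_coe]
    exact hd₁
  have hdom₂ : T.domain ≤ t.domain := ht.2.1.1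
  let f : M →ₗ[ℂ] E₂ := e₂.symm.toLinearMap ∘ₗ Submodule.inclusion hdom₂ ∘ₗ
    (D₁.toLinearMap.restrict (p := M) (q := T.domain) fun x hx => hx)
  have hf : ∀ x : M, D₂ (f x) = D₁ x := fun x => by
    rw [← he₂]
    simp [f]
  have hfb : ∃ C, ∀ x, ‖f x‖ ≤ C * ‖M.subtype x‖ := by
    refine ⟨√(|C| * (‖j₁‖ + |l₁ - m| * ‖D₁‖ ^ 2)), fun x => ?_⟩
    have h1 := hC' (f x) ((hf x).symm ▸ x.2)
    simp only [hf] at h1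
    have h2 := h1.trans (mul_le_mul_of_nonneg_left (hub x x.2) (abs_nonneg C))
    rw [← mul_assoc] at h2
    have h3 := Real.le_sqrt_of_sq_le h2
    rwa [Real.sqrt_mul' _ (sq_nonneg _), Real.sqrt_sq (norm_nonneg _)] at h3
  let L : E₁ →L[ℂ] E₂ := f.extendOfNorm M.subtype
  have hL : ∀ x : M, L x = f x := fun x => LinearMap.extendOfNorm_eq hM hfb x
  -- The extension by continuity still commutes with the maps into `H`; this puts `dom s` inside
  -- `dom t`.
  have hDL : ∀ x, D₂ (L x) = D₁ x := fun x =>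
    hd₁.induction (P := fun x => D₂ (L x) = D₁ x) (fun x hx => by
      rw [hL ⟨x, hx⟩, hf]) (isClosed_eq (by fun_prop) (by fun_prop)) x
  have hform : ∀ x y, t.form (e₂ (L x)) (e₂ (L y)) = s.form (e₁ x) (e₁ y) := fun x y => by
    rw [hf₁, hf₂]
    refine hd₁.induction (P := fun x => ⟪j₂ (L x), L y⟫_ℂ + l₂ * ⟪D₂ (L x), D₂ (L y)⟫_ℂ
      = ⟪j₁ x, y⟫_ℂ + l₁ * ⟪D₁ x, D₁ y⟫_ℂ) (fun x hx => ?_)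
      (isClosed_eq (by fun_prop) (by fun_prop)) x
    refine hd₁.induction (P := fun y => ⟪j₂ (L x), L y⟫_ℂ + l₂ * ⟪D₂ (L x), D₂ (L y)⟫_ℂ
      = ⟪j₁ x, y⟫_ℂ + l₁ * ⟪D₁ x, D₁ y⟫_ℂ) (fun y hy => ?_)
      (isClosed_eq (by fun_prop) (by fun_prop)) y
    rw [← hf₁, ← hf₂, ← hT₁ x y hx hy, ← hT₂ (L x) (L y) ((hDL x).symm ▸ hx) ((hDL y).symm ▸ hy)]
    simp only [hDL]
  have hmem : ∀ x : s.domain, (x : H) = e₂ (L (e₁.symm x)) := fun x => by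
    rw [he₂, hDL, ← he₁, e₁.apply_symm_apply]
  refine ⟨fun x hx => ?_, fun x y => ?_⟩
  · rw [show x = e₂ (L (e₁.symm ⟨x, hx⟩)) from hmem ⟨x, hx⟩]
    exact (e₂ _).2
  have hincl : ∀ (h : s.domain ≤ t.domain) (x : s.domain),
      Submodule.inclusion h x = e₂ (L (e₁.symm x)) := fun h x => Subtype.ext (hmem x)
  rw [hincl, hincl, hform, e₁.apply_symm_apply, e₁.apply_symm_apply]

theorem SymForm.IsExtension.antisymm {H : Type u} [NormedAddCommGroup H] [InnerProductSpace ℂ H]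
    {s t : SymForm H} (hst : SymForm.IsExtension s t)
    (hts : SymForm.IsExtension t s) : s = t := by
  obtain ⟨K, B, hK, hB⟩ := s
  obtain ⟨L, C, hL, hC⟩ := t
  obtain ⟨h1, h2⟩ := hst
  obtain rfl : K = L := le_antisymm h1 hts.1
  have : B = C := LinearMap.ext₂ fun x y => (h2 x y).symm
  subst this
  rfl

end Semibounded

/-! ### Spectral calculus for `S`: square root of the modulus, sign, localized vectors -/

section FunctionalCalculus

variable {H : Type*} [NormedAddCommGroup H] [InnerProductSpace ℂ H] [CompleteSpace H]

theorem inner_cfc_left (f : ℝ → ℝ) (S : H →L[ℂ] H) (x y : H) :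
    ⟪cfc f S x, y⟫_ℂ = ⟪x, cfc f S y⟫_ℂ := by
  have h : IsSelfAdjoint (cfc f S) := cfc_predicate f S
  rw [← ContinuousLinearMap.adjoint_inner_left, h.adjoint_eq]

theorem cfc_apply_cfc_apply {f g : ℝ → ℝ} (hf : Continuous f) (hg : Continuous g)
    (S : H →L[ℂ] H) (x : H) : cfc f S (cfc g S x) = cfc (fun t => f t * g t) S x := by
  rw [cfc_mul f g S hf.continuousOn hg.continuousOn]
  rfl

theorem norm_cfc_apply_sq {f : ℝ → ℝ} (hf : Continuous f) (S : H →L[ℂ] H) (x : H) :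
    ‖cfc f S x‖ ^ 2 = (⟪cfc (fun t => f t * f t) S x, x⟫_ℂ).re := by
  rw [← cfc_apply_cfc_apply hf hf, inner_cfc_left]
  exact (inner_self_eq_norm_sq (𝕜 := ℂ) _).symm

theorem re_inner_cfc_le {f g : ℝ → ℝ} (hf : Continuous f) (hg : Continuous g) {S : H →L[ℂ] H}
    (h : ∀ t ∈ spectrum ℝ S, f t ≤ g t) (x : H) :
    (⟪cfc f S x, x⟫_ℂ).re ≤ (⟪cfc g S x, x⟫_ℂ).re := by
  have h1 : cfc f S ≤ cfc g S := cfc_mono h hf.continuousOn hg.continuousOn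
  have h2 := ((ContinuousLinearMap.le_def _ _).1 h1).re_inner_nonneg_left x
  rw [sub_apply, inner_sub_left, map_sub] at h2
  exact sub_nonneg.1 h2

/-- A gap of the spectrum of `S` to the right of zero bounds the form of `S⁻¹` from above. -/
theorem re_inner_le_of_spectrum_gap {S : H →L[ℂ] H} (hS : IsSelfAdjoint S) {ε : ℝ} (hε : 0 < ε)
    (h : ∀ s ∈ spectrum ℝ S, 0 < s → ε ≤ s) (x : H) : (⟪S x, x⟫_ℂ).re ≤ ε⁻¹ * ‖S x‖ ^ 2 := by
  have h1 : S = cfc (fun t : ℝ => t) S := (cfc_id' ℝ S hS).symm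
  have h2 := norm_cfc_apply_sq (f := fun t : ℝ => √ε⁻¹ * t) (by fun_prop) S x
  rw [cfc_const_mul (√ε⁻¹) (fun t : ℝ => t) S continuousOn_id, ← h1] at h2
  have h3 : ‖(√ε⁻¹ • S) x‖ ^ 2 = ε⁻¹ * ‖S x‖ ^ 2 := by
    rw [smul_apply, norm_smul, mul_pow, Real.norm_of_nonneg (by positivity),
      Real.sq_sqrt (by positivity)]
  rw [← h3, h2]
  nth_rewrite 1 [h1]
  -- It remains to see `t ≤ ε⁻¹ t²` on the spectrum: trivial for `t ≤ 0`, and the gap gives `t ≥ ε`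
  -- otherwise.
  refine re_inner_cfc_le (by fun_prop) (by fun_prop) (fun t ht => ?_) x
  have h4 : √ε⁻¹ * t * (√ε⁻¹ * t) = ε⁻¹ * (t * t) := by
    rw [mul_mul_mul_comm, Real.mul_self_sqrt (by positivity)]
  rw [h4]
  rcases le_or_gt t 0 with h0 | h0
  · exact h0.trans (mul_nonneg (by positivity) (mul_self_nonneg t))
  · rw [← mul_assoc]
    refine le_mul_of_one_le_left h0.le ?_
    rw [inv_mul_eq_div, one_le_div hε]
    exact h t ht h0

/-- The function `sign t * √|t|`. -/
noncomputable def signSqrtFun (t : ℝ) : ℝ := √t - √(-t)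

theorem continuous_signSqrtFun : Continuous signSqrtFun := by
  unfold signSqrtFun
  fun_prop

theorem signSqrtFun_of_nonneg {t : ℝ} (ht : 0 ≤ t) : signSqrtFun t = √|t| := by
  rw [signSqrtFun, Real.sqrt_eq_zero_of_nonpos (neg_nonpos.2 ht), sub_zero, abs_of_nonneg ht]

theorem signSqrtFun_neg (t : ℝ) : signSqrtFun (-t) = -signSqrtFun t := by
  simp [signSqrtFun]

theorem signSqrtFun_mul_self (t : ℝ) : signSqrtFun t * signSqrtFun t = √|t| * √|t| := by
  rcases le_total 0 t with h | h
  · rw [signSqrtFun_of_nonneg h]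
  · rw [← neg_neg t, signSqrtFun_neg, signSqrtFun_of_nonneg (neg_nonneg.2 h), neg_mul_neg,
      abs_neg (-t)]

theorem sqrt_abs_mul_signSqrtFun (t : ℝ) : √|t| * signSqrtFun t = t := by
  rcases le_total 0 t with h | h
  · rw [signSqrtFun_of_nonneg h, Real.mul_self_sqrt (abs_nonneg t), abs_of_nonneg h]
  · obtain ⟨s, rfl⟩ : ∃ s, t = -s := ⟨-t, (neg_neg t).symm⟩
    have hs : 0 ≤ s := neg_nonpos.1 h
    rw [signSqrtFun_neg, signSqrtFun_of_nonneg hs, abs_neg, mul_neg,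
      Real.mul_self_sqrt (abs_nonneg s), abs_of_nonneg hs]

/-- The operator `|S| ^ (1 / 2)`. -/
noncomputable def sqrtAbs (S : H →L[ℂ] H) : H →L[ℂ] H := cfc (fun t : ℝ => √|t|) S

/-- The operator `sign S * |S| ^ (1 / 2)`. -/
noncomputable def signSqrt (S : H →L[ℂ] H) : H →L[ℂ] H := cfc signSqrtFun S

theorem sqrtAbs_neg (S : H →L[ℂ] H) (hS : IsSelfAdjoint S) : sqrtAbs (-S) = sqrtAbs S := by
  rw [sqrtAbs, ← cfc_comp_neg (fun t : ℝ => √|t|) S (by fun_prop)]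
  simp only [abs_neg]
  rfl

theorem signSqrt_neg (S : H →L[ℂ] H) (hS : IsSelfAdjoint S) : signSqrt (-S) = -signSqrt S := by
  rw [signSqrt, ← cfc_comp_neg signSqrtFun S continuous_signSqrtFun.continuousOn]
  simp only [signSqrtFun_neg]
  exact cfc_neg signSqrtFun S

theorem inner_sqrtAbs_left (S : H →L[ℂ] H) (x y : H) :
    ⟪sqrtAbs S x, y⟫_ℂ = ⟪x, sqrtAbs S y⟫_ℂ :=
  inner_cfc_left _ S x y

theorem adjoint_sqrtAbs (S : H →L[ℂ] H) : ContinuousLinearMap.adjoint (sqrtAbs S) = sqrtAbs S :=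
  IsSelfAdjoint.adjoint_eq (cfc_predicate (fun t : ℝ => √|t|) S)

theorem sqrtAbs_signSqrt_apply {S : H →L[ℂ] H} (hS : IsSelfAdjoint S) (x : H) :
    sqrtAbs S (signSqrt S x) = S x := by
  rw [sqrtAbs, signSqrt, cfc_apply_cfc_apply (by fun_prop) continuous_signSqrtFun]
  simp only [sqrt_abs_mul_signSqrtFun]
  rw [cfc_id' ℝ S hS]

theorem signSqrt_sqrtAbs_apply {S : H →L[ℂ] H} (hS : IsSelfAdjoint S) (x : H) :
    signSqrt S (sqrtAbs S x) = S x := by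
  rw [sqrtAbs, signSqrt, cfc_apply_cfc_apply continuous_signSqrtFun (by fun_prop)]
  simp only [mul_comm (signSqrtFun _), sqrt_abs_mul_signSqrtFun]
  rw [cfc_id' ℝ S hS]

/-- The two functions have the same square. Hence `sqrtAbs S x ↦ signSqrt S x` is isometric, and its
continuous extension is the sign of `S`. -/
theorem norm_signSqrt_apply (S : H →L[ℂ] H) (x : H) : ‖signSqrt S x‖ = ‖sqrtAbs S x‖ := by
  rw [← sq_eq_sq₀ (norm_nonneg _) (norm_nonneg _), signSqrt, sqrtAbs,
    norm_cfc_apply_sq continuous_signSqrtFun, norm_cfc_apply_sq (by fun_prop)]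
  simp only [signSqrtFun_mul_self]

theorem sqrtAbs_injective {S : H →L[ℂ] H} (hS : IsSelfAdjoint S) (h : Function.Injective S) :
    Function.Injective (sqrtAbs S) := by
  refine Function.Injective.of_comp (f := signSqrt S) ?_
  have : signSqrt S ∘ sqrtAbs S = S := funext (signSqrt_sqrtAbs_apply hS)
  rwa [this]

/-- The sign of an injective self-adjoint operator. -/
theorem exists_sign {S : H →L[ℂ] H} (hS : IsSelfAdjoint S) (h : Function.Injective S) :
    ∃ J : H →L[ℂ] H, (∀ x y, ⟪J x, y⟫_ℂ = ⟪x, J y⟫_ℂ) ∧ (∀ x, J (J x) = x) ∧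
      ∀ x, J (sqrtAbs S x) = signSqrt S x := by
  have hdense : DenseRange (sqrtAbs S) := by
    have := denseRange_adjoint_of_injective _ (sqrtAbs_injective hS h)
    rwa [adjoint_sqrtAbs] at this
  let J : H →L[ℂ] H := (signSqrt S).toLinearMap.extendOfNorm (sqrtAbs S).toLinearMap
  have hJ : ∀ x, J (sqrtAbs S x) = signSqrt S x := fun x =>
    LinearMap.extendOfNorm_eq (f := (signSqrt S).toLinearMap) (e := (sqrtAbs S).toLinearMap)
      hdense ⟨1, fun x => by
        rw [one_mul]
        exact (norm_signSqrt_apply S x).le⟩ x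
  have hJs : ∀ x y, ⟪J x, y⟫_ℂ = ⟪x, J y⟫_ℂ := fun x y => by
    refine hdense.induction_on₂ (p := fun x y => ⟪J x, y⟫_ℂ = ⟪x, J y⟫_ℂ)
      (isClosed_eq (by fun_prop) (by fun_prop)) (fun x y => ?_) x y
    rw [hJ, hJ, ← inner_sqrtAbs_left, sqrtAbs_signSqrt_apply hS, inner_sqrtAbs_left,
      sqrtAbs_signSqrt_apply hS]
    have := inner_cfc_left id S x y
    rwa [cfc_id ℝ S hS] at this
  have hn : ∀ x, ‖J x‖ = ‖x‖ := fun x =>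
    hdense.induction_on (p := fun x => ‖J x‖ = ‖x‖) x (isClosed_eq (by fun_prop) (by fun_prop))
      fun x => by rw [hJ, norm_signSqrt_apply]
  refine ⟨J, hJs, fun x => ?_, hJ⟩
  -- A symmetric isometry is an involution.
  let j : H →ₗᵢ[ℂ] H := ⟨J.toLinearMap, hn⟩
  refine ext_inner_right ℂ fun y => ?_
  rw [hJs]
  exact j.inner_map_map x y

/-- A tent function at `s`, supported in `[s / 2, 3 * s / 2]`. -/
noncomputable def tent (s t : ℝ) : ℝ := max 0 (1 - 2 / s * |t - s|)

theorem continuous_tent (s : ℝ) : Continuous (tent s) := by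
  unfold tent
  fun_prop

theorem tent_self (s : ℝ) : tent s s = 1 := by simp [tent]

theorem mem_Ioo_of_tent_ne_zero {s t : ℝ} (hs : 0 < s) (h : tent s t ≠ 0) :
    s / 2 < t ∧ t < 3 / 2 * s := by
  by_contra hc
  apply h
  have h1 : s / 2 ≤ |t - s| := by
    by_contra hc'
    rw [not_le, abs_lt] at hc'
    exact hc ⟨by linarith, by linarith⟩
  rw [tent, max_eq_left]
  have : 2 / s * (s / 2) ≤ 2 / s * |t - s| := by gcongr
  rw [div_mul_div_cancel₀ hs.ne', div_self two_ne_zero] at this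
  linarith

/-- Points of a set accumulating at zero from the right that decrease rapidly. -/
theorem exists_rapidly_decreasing {A : Set ℝ} (h : ∀ ε > 0, ∃ s ∈ A, 0 < s ∧ s < ε) :
    ∃ s : ℕ → ℝ, (∀ n, s n ∈ A) ∧ (∀ n, 0 < s n) ∧ (∀ n, 3 / 2 * s n ≤ (1 / 64) ^ n) ∧
      ∀ m n, m < n → 3 / 2 * s n ≤ s m / 2 := by
  choose g hgA hg0 hg using h
  have h64 : ∀ x : {x : ℝ // 0 < x}, 0 < x.1 / 64 := fun x => div_pos x.2 (by norm_num)
  -- The seed `1 / 2` need not lie in `A`, so the sequence is read from index one on. The ratio `64`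
  -- is the square of the decay `8` wanted for the square root, and it also separates the supports
  -- of the tents.
  let f : ℕ → {x : ℝ // 0 < x} := fun n => Nat.rec ⟨1 / 2, by norm_num⟩
    (fun _ x => ⟨g (x.1 / 64) (h64 x), hg0 _ _⟩) n
  have hf : ∀ n, (f (n + 1)).1 = g ((f n).1 / 64) (h64 (f n)) := fun n => rfl
  have hlt : ∀ n, (f (n + 1)).1 < (f n).1 / 64 := fun n => by
    rw [hf]
    exact hg _ _
  have hle : ∀ n, (f n).1 ≤ 1 / 2 * (1 / 64) ^ n := fun n => by
    induction n with
    | zero => simp [f]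
    | succ n ih =>
      rw [pow_succ]
      linarith [hlt n]
  have hanti : Antitone fun n => (f n).1 := antitone_nat_of_succ_le fun n => by
    linarith [hlt n, (f n).2]
  refine ⟨fun n => (f (n + 1)).1, fun n => ?_, fun n => (f (n + 1)).2, fun n => ?_,
    fun m n hmn => ?_⟩
  · exact hgA _ _
  · linarith [hlt n, hle n, (f n).2]
  · have h1 : (f (n + 1)).1 ≤ (f (m + 1 + 1)).1 :=
      hanti (show m + 1 + 1 ≤ n + 1 by omega)
    linarith [hlt (m + 1), (f (m + 1)).2]

/-- If the spectrum of `S` accumulates at zero from the right, there is an orthonormal sequence in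
the positive part of the range of `|S| ^ (1 / 2)` on which this operator decays rapidly. -/
theorem exists_orthonormal_of_spectrum {S : H →L[ℂ] H} (hS : IsSelfAdjoint S)
    (h : ∀ ε > 0, ∃ s ∈ spectrum ℝ S, 0 < s ∧ s < ε) :
    ∃ u : ℕ → H, Orthonormal ℂ u ∧ (∀ n, ∃ w, sqrtAbs S w = u n ∧ signSqrt S w = u n) ∧
      ∀ n, ‖sqrtAbs S (u n)‖ ≤ (1 / 8) ^ n := by
  obtain ⟨s, hsA, hs0, hs, hsm⟩ := exists_rapidly_decreasing h
  have hc : ∀ n, Continuous fun t : ℝ => √|t| * tent (s n) t := fun n =>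
    Continuous.mul (by fun_prop) (continuous_tent _)
  have hz : ∀ n, ∃ z, cfc (fun t : ℝ => √|t| * tent (s n) t) S z ≠ 0 := fun n => by
    by_contra! hz
    have h0 : cfc (fun t : ℝ => √|t| * tent (s n) t) S = cfc (fun _ : ℝ => (0 : ℝ)) S := by
      rw [cfc_const_zero]
      -- If the operator vanished, so would its function on the spectrum, but its value at the
      -- spectral point `s n` is `√(s n)`.
      exact ContinuousLinearMap.ext hz
    have h1 := eqOn_of_cfc_eq_cfc h0 (hc n).continuousOn continuousOn_const hS (hsA n)
    simp only [tent_self, mul_one] at h1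
    rw [Real.sqrt_eq_zero (abs_nonneg _), abs_eq_zero] at h1
    exact (hs0 n).ne' h1
  choose z hz using hz
  -- The factor `√|t|` puts `v n` in the range of `sqrtAbs S`; the tent localizes it near `s n > 0`,
  -- where `signSqrt S` and `sqrtAbs S` agree.
  let v : ℕ → H := fun n => cfc (fun t : ℝ => √|t| * tent (s n) t) S (z n)
  have hv : ∀ n, ‖v n‖ ≠ 0 := fun n => norm_ne_zero_iff.2 (hz n)
  have hvR : ∀ n, sqrtAbs S (cfc (tent (s n)) S (z n)) = v n := fun n =>
    cfc_apply_cfc_apply (by fun_prop) (continuous_tent _) S _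
  have hvQ : ∀ n, signSqrt S (cfc (tent (s n)) S (z n)) = v n := fun n => by
    refine (cfc_apply_cfc_apply continuous_signSqrtFun (continuous_tent _) S _).trans ?_
    have : (fun t => signSqrtFun t * tent (s n) t) = fun t => √|t| * tent (s n) t := by
      ext t
      by_cases ht : tent (s n) t = 0
      · simp [ht]
      · rw [signSqrtFun_of_nonneg]
        linarith [(mem_Ioo_of_tent_ne_zero (hs0 n) ht).1, hs0 n]
    rw [this]
  have hvo : ∀ m n, m < n → ⟪v m, v n⟫_ℂ = 0 := fun m n hmn => by
    simp only [v]
    rw [inner_cfc_left, cfc_apply_cfc_apply (hc m) (hc n)]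
    have : (fun t => √|t| * tent (s m) t * (√|t| * tent (s n) t)) = fun _ : ℝ => (0 : ℝ) := by
      ext t
      by_cases h1 : tent (s m) t = 0
      · simp [h1]
      by_cases h2 : tent (s n) t = 0
      · simp [h2]
      linarith [(mem_Ioo_of_tent_ne_zero (hs0 m) h1).1, (mem_Ioo_of_tent_ne_zero (hs0 n) h2).2,
        hsm m n hmn]
    rw [this, cfc_const_zero]
    simp
  have hvn : ∀ n, ‖sqrtAbs S (v n)‖ ≤ (1 / 8) ^ n * ‖v n‖ := fun n => by
    rw [← sq_le_sq₀ (norm_nonneg _) (by positivity), mul_pow]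
    -- On the support of the tent, `|t| ≤ 3 / 2 * s n`.
    have h1 : ‖sqrtAbs S (v n)‖ ^ 2 ≤ 3 / 2 * s n * ‖v n‖ ^ 2 := by
      simp only [v, sqrtAbs]
      have h2 : ∀ x, 3 / 2 * s n * ‖cfc (fun t : ℝ => √|t| * tent (s n) t) S x‖ ^ 2
          = ‖cfc (fun t : ℝ => √(3 / 2 * s n) * (√|t| * tent (s n) t)) S x‖ ^ 2 := fun x => by
        have := hs0 n
        rw [cfc_const_mul _ _ S (hc n).continuousOn, smul_apply, norm_smul,
          mul_pow, Real.norm_of_nonneg (by positivity), Real.sq_sqrt (by positivity)]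
      rw [h2, cfc_apply_cfc_apply (by fun_prop) (hc n),
        norm_cfc_apply_sq (by exact Continuous.mul (by fun_prop) (hc n)),
        norm_cfc_apply_sq (by exact continuous_const.mul (hc n))]
      refine re_inner_cfc_le ?_ ?_ (fun t _ => ?_) _
      · exact (Continuous.mul (by fun_prop) (hc n)).mul (Continuous.mul (by fun_prop) (hc n))
      · exact (continuous_const.mul (hc n)).mul (continuous_const.mul (hc n))
      · rw [mul_mul_mul_comm, mul_mul_mul_comm (√(3 / 2 * s n)),
          Real.mul_self_sqrt (abs_nonneg t), Real.mul_self_sqrt (by have := hs0 n; positivity)]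
        by_cases ht : tent (s n) t = 0
        · simp [ht]
        · have h3 := mem_Ioo_of_tent_ne_zero (hs0 n) ht
          refine mul_le_mul_of_nonneg_right ?_ (mul_self_nonneg _)
          rw [abs_of_nonneg (by linarith [hs0 n])]
          exact h3.2.le
    refine h1.trans ?_
    gcongr
    rw [← pow_mul, mul_comm n 2, pow_mul]
    norm_num
    have := hs n
    norm_num at this
    exact this
  refine ⟨fun n => ((‖v n‖⁻¹ : ℝ) : ℂ) • v n, ⟨fun n => ?_, fun m n hmn => ?_⟩, fun n => ?_,
    fun n => ?_⟩
  · rw [norm_smul, Complex.norm_real, norm_inv, norm_norm, inv_mul_cancel₀ (hv n)]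
  · change ⟪((‖v m‖⁻¹ : ℝ) : ℂ) • v m, ((‖v n‖⁻¹ : ℝ) : ℂ) • v n⟫_ℂ = 0
    rw [inner_smul_left, inner_smul_right]
    rcases lt_or_gt_of_ne hmn with hlt | hlt
    · rw [hvo m n hlt]
      simp
    · rw [← inner_conj_symm, hvo n m hlt]
      simp
  · exact ⟨((‖v n‖⁻¹ : ℝ) : ℂ) • cfc (tent (s n)) S (z n), by rw [map_smul, hvR],
      by rw [map_smul, hvQ]⟩
  · rw [map_smul, norm_smul, Complex.norm_real, norm_inv, norm_norm,
      inv_mul_le_iff₀ ((norm_nonneg _).lt_of_ne' (hv n)), mul_comm]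
    exact hvn n

end FunctionalCalculus

/-! ### Hyperbolic rotations and a second factorization -/

section HyperbolicRotation

variable {H : Type*} [NormedAddCommGroup H] [InnerProductSpace ℂ H]

/-- The difference from the identity of the operator that multiplies `p` by `4 ^ n` and `q`
by `4⁻¹ ^ n`. -/
noncomputable def boost (p q : ℕ → H) (n : ℕ) : H →L[ℂ] H :=
  ((4 : ℂ) ^ n - 1) • InnerProductSpace.rankOne ℂ (p n) (p n)
    + (((4 : ℂ) ^ n)⁻¹ - 1) • InnerProductSpace.rankOne ℂ (q n) (q n)

theorem boost_apply (p q : ℕ → H) (n : ℕ) (x : H) :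
    boost p q n x = ((4 : ℂ) ^ n - 1) • ⟪p n, x⟫_ℂ • p n
      + (((4 : ℂ) ^ n)⁻¹ - 1) • ⟪q n, x⟫_ℂ • q n := by
  simp [boost]

theorem inner_boost_left (p q : ℕ → H) (n : ℕ) (x y : H) :
    ⟪boost p q n x, y⟫_ℂ = ⟪x, boost p q n y⟫_ℂ := by
  simp only [boost_apply, inner_add_left, inner_add_right, inner_smul_left, inner_smul_right,
    map_sub, map_pow, map_inv₀, map_one, inner_conj_symm, map_ofNat]
  ring

variable {p q : ℕ → H} {J : H →L[ℂ] H}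

/-- The identity plus the first `N` of the operators `boost p q n`. -/
noncomputable def boostSum (p q : ℕ → H) (N : ℕ) : H →L[ℂ] H :=
  1 + ∑ n ∈ Finset.range N, boost p q n

theorem boostSum_apply (p q : ℕ → H) (N : ℕ) (x : H) :
    boostSum p q N x = x + ∑ n ∈ Finset.range N, boost p q n x := by
  simp [boostSum]

theorem inner_boostSum_left (p q : ℕ → H) (N : ℕ) (x y : H) :
    ⟪boostSum p q N x, y⟫_ℂ = ⟪x, boostSum p q N y⟫_ℂ := by
  simp only [boostSum_apply, inner_add_left, inner_add_right, sum_inner, inner_sum,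
    inner_boost_left]

theorem boost_apply_left (hp : Orthonormal ℂ p) (hpq : ∀ m n, ⟪p m, q n⟫_ℂ = 0) (n m : ℕ) :
    boost p q n (p m) = if n = m then ((4 : ℂ) ^ n - 1) • p n else 0 := by
  have h : ⟪q n, p m⟫_ℂ = 0 := by rw [← inner_conj_symm, hpq, map_zero]
  rw [boost_apply, h, orthonormal_iff_ite.1 hp]
  split_ifs <;> simp

theorem boost_apply_right (hq : Orthonormal ℂ q) (hpq : ∀ m n, ⟪p m, q n⟫_ℂ = 0) (n m : ℕ) :
    boost p q n (q m) = if n = m then (((4 : ℂ) ^ n)⁻¹ - 1) • q n else 0 := by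
  rw [boost_apply, hpq, orthonormal_iff_ite.1 hq]
  split_ifs <;> simp

theorem boostSum_apply_left (hp : Orthonormal ℂ p) (hpq : ∀ m n, ⟪p m, q n⟫_ℂ = 0) {N m : ℕ}
    (hm : m < N) : boostSum p q N (p m) = (4 : ℂ) ^ m • p m := by
  simp only [boostSum_apply, boost_apply_left hp hpq]
  rw [Finset.sum_ite_eq' (Finset.range N) m, if_pos (Finset.mem_range.2 hm)]
  module

theorem boostSum_apply_right (hq : Orthonormal ℂ q) (hpq : ∀ m n, ⟪p m, q n⟫_ℂ = 0) {N m : ℕ}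
    (hm : m < N) : boostSum p q N (q m) = ((4 : ℂ) ^ m)⁻¹ • q m := by
  simp only [boostSum_apply, boost_apply_right hq hpq]
  rw [Finset.sum_ite_eq' (Finset.range N) m, if_pos (Finset.mem_range.2 hm)]
  module

/-- The operators `boostSum p q N` are isometries for the form `⟪J ·, ·⟫`. -/
theorem boostSum_J_boostSum (hJ : ∀ x y, ⟪J x, y⟫_ℂ = ⟪x, J y⟫_ℂ) (hJp : ∀ n, J (p n) = q n)
    (hJq : ∀ n, J (q n) = p n) (hp : Orthonormal ℂ p) (hq : Orthonormal ℂ q)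
    (hpq : ∀ m n, ⟪p m, q n⟫_ℂ = 0) (N : ℕ) (x : H) :
    boostSum p q N (J (boostSum p q N x)) = J x := by
  have hFJ : ∀ n x, boost p q n (J x) = ((4 : ℂ) ^ n - 1) • ⟪q n, x⟫_ℂ • p n
      + (((4 : ℂ) ^ n)⁻¹ - 1) • ⟪p n, x⟫_ℂ • q n := fun n x => by
    rw [boost_apply, ← hJ, ← hJ, hJp, hJq]
  have hJF : ∀ n x, J (boost p q n x) = ((4 : ℂ) ^ n - 1) • ⟪p n, x⟫_ℂ • q n
      + (((4 : ℂ) ^ n)⁻¹ - 1) • ⟪q n, x⟫_ℂ • p n := fun n x => by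
    rw [boost_apply]
    simp only [map_add, map_smul, hJp, hJq]
  have hFF : ∀ m n x, m ≠ n → boost p q m (J (boost p q n x)) = 0 := fun m n x hmn => by
    rw [hJF]
    simp only [map_add, map_smul, boost_apply_left hp hpq, boost_apply_right hq hpq, if_neg hmn,
      smul_zero, add_zero]
  -- This is `(1 + F) J (1 + F) = J` for one pair: `J` exchanges `p n` and `q n`, so the factors
  -- `4ⁿ` and `4⁻ⁿ` cancel.
  have hsame : ∀ n x, boost p q n (J x) + J (boost p q n x)
      + boost p q n (J (boost p q n x)) = 0 := fun n x => by
    have h4 : (4 : ℂ) ^ n ≠ 0 := pow_ne_zero n (by norm_num)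
    rw [hFJ n x, hJF]
    simp only [map_add, map_smul, boost_apply_left hp hpq, boost_apply_right hq hpq, if_true]
    match_scalars
    · field_simp
      ring
    · field_simp
      ring
  -- Different pairs do not interact, so the pairs can be added one at a time.
  have hVF : ∀ N n x, N ≤ n → boostSum p q N (J (boost p q n x)) = J (boost p q n x) :=
    fun N n x hn => by
      rw [boostSum_apply, Finset.sum_eq_zero, add_zero]
      intro m hm
      exact hFF m n x (by have := Finset.mem_range.1 hm; omega)
  have hFV : ∀ N n x, N ≤ n → boost p q n (J (boostSum p q N x)) = boost p q n (J x) :=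
    fun N n x hn => by
      rw [boostSum_apply, map_add, map_add, map_sum, map_sum, Finset.sum_eq_zero, add_zero]
      intro m hm
      exact hFF n m x (by have := Finset.mem_range.1 hm; omega)
  induction N with
  | zero => simp [boostSum]
  | succ N ih =>
    have hs : ∀ y, boostSum p q (N + 1) y = boostSum p q N y + boost p q N y := fun y => by
      rw [boostSum_apply, boostSum_apply, Finset.sum_range_succ, add_assoc]
    rw [hs x, map_add, map_add, hs, hs, ih, hFV N N x le_rfl, hVF N N x le_rfl]
    have := hsame N x
    rw [add_assoc, ← add_assoc (boost p q N (J x)), this, add_zero]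

variable [CompleteSpace H]

/-- The coefficients `2⁻ⁿ` are summable, yet become the unbounded `2ⁿ` after multiplication by `4ⁿ`.
-/
theorem exists_inner_eq_of_orthonormal (hp : Orthonormal ℂ p) :
    ∃ x, ∀ n, ⟪x, p n⟫_ℂ = (1 / 2 : ℂ) ^ n := by
  have hsum : Summable fun n => (1 / 2 : ℂ) ^ n • p n := by
    refine Summable.of_norm ?_
    simp only [norm_smul, hp.1, mul_one, norm_pow]
    exact summable_geometric_of_lt_one (norm_nonneg _) (by norm_num)
  refine ⟨∑' n, (1 / 2 : ℂ) ^ n • p n, fun n => ?_⟩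
  rw [← inner_conj_symm, ← innerSL_apply_apply ℂ (p n), ContinuousLinearMap.map_tsum _ hsum]
  simp only [map_smul, innerSL_apply_apply, orthonormal_iff_ite.1 hp]
  simp [map_ofNat]

/-- If `R` decays rapidly on a sequence of hyperbolic pairs in its range, then `R J R` has another
factorization `D J D*`, and the range of `D` is not contained in that of `R`. -/
theorem exists_factorization {R : H →L[ℂ] H} (hR : ∀ x y, ⟪R x, y⟫_ℂ = ⟪x, R y⟫_ℂ)
    (hRinj : Function.Injective R) (hJ : ∀ x y, ⟪J x, y⟫_ℂ = ⟪x, J y⟫_ℂ)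
    (hJp : ∀ n, J (p n) = q n) (hJq : ∀ n, J (q n) = p n) (hp : Orthonormal ℂ p)
    (hq : Orthonormal ℂ q) (hpq : ∀ m n, ⟪p m, q n⟫_ℂ = 0) (hpR : ∀ n, ∃ w, R w = p n)
    (hqR : ∀ n, ∃ w, R w = q n) (hp' : ∀ n, ‖R (p n)‖ ≤ 2 * (1 / 8) ^ n)
    (hq' : ∀ n, ‖R (q n)‖ ≤ 2 * (1 / 8) ^ n) :
    ∃ D : H →L[ℂ] H, Function.Injective D ∧
      (∀ y, D (J (ContinuousLinearMap.adjoint D y)) = R (J (R y))) ∧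
      ∃ x, ∀ y, D x ≠ R y := by
  -- Each of the two rank-one terms contributes at most `4ⁿ · 2 · 8⁻ⁿ`.
  have hbound : ∀ n, ‖R.comp (boost p q n)‖ ≤ 4 * (1 / 2) ^ n := fun n => by
    refine ContinuousLinearMap.opNorm_le_bound _ (by positivity) fun x => ?_
    have h4 : ‖(4 : ℂ) ^ n - 1‖ ≤ 4 ^ n := by
      have : (4 : ℂ) ^ n - 1 = ((4 ^ n - 1 : ℝ) : ℂ) := by push_cast; rfl
      have h1 : (1 : ℝ) ≤ 4 ^ n := one_le_pow₀ (by norm_num)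
      rw [this, Complex.norm_real, Real.norm_of_nonneg (by linarith)]
      linarith
    have h4' : ‖((4 : ℂ) ^ n)⁻¹ - 1‖ ≤ 4 ^ n := by
      have : ((4 : ℂ) ^ n)⁻¹ - 1 = -((1 - (4 ^ n)⁻¹ : ℝ) : ℂ) := by push_cast; ring
      have h1 : (1 : ℝ) ≤ 4 ^ n := one_le_pow₀ (by norm_num)
      have h2 : ((4 : ℝ) ^ n)⁻¹ ≤ 1 := inv_le_one_of_one_le₀ h1
      have h3 : 0 ≤ ((4 : ℝ) ^ n)⁻¹ := by positivity
      rw [this, norm_neg, Complex.norm_real, Real.norm_of_nonneg (by linarith)]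
      linarith
    have hpx : ‖⟪p n, x⟫_ℂ‖ ≤ ‖x‖ := by
      simpa [hp.1 n] using norm_inner_le_norm (𝕜 := ℂ) (p n) x
    have hqx : ‖⟪q n, x⟫_ℂ‖ ≤ ‖x‖ := by
      simpa [hq.1 n] using norm_inner_le_norm (𝕜 := ℂ) (q n) x
    rw [ContinuousLinearMap.comp_apply, boost_apply, map_add, map_smul, map_smul, map_smul,
      map_smul]
    refine (norm_add_le _ _).trans ?_
    rw [norm_smul, norm_smul, norm_smul, norm_smul]
    calc ‖(4 : ℂ) ^ n - 1‖ * (‖⟪p n, x⟫_ℂ‖ * ‖R (p n)‖)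
          + ‖((4 : ℂ) ^ n)⁻¹ - 1‖ * (‖⟪q n, x⟫_ℂ‖ * ‖R (q n)‖)
        ≤ 4 ^ n * (‖x‖ * (2 * (1 / 8) ^ n)) + 4 ^ n * (‖x‖ * (2 * (1 / 8) ^ n)) := by
          gcongr
          · exact hp' n
          · exact hq' n
      _ = 4 * (4 ^ n * (1 / 8) ^ n) * ‖x‖ := by ring
      _ = 4 * (1 / 2) ^ n * ‖x‖ := by
          rw [← mul_pow]
          norm_num
  have hsum : Summable fun n => R.comp (boost p q n) :=
    Summable.of_norm_bounded
      ((summable_geometric_of_lt_one (by norm_num) (by norm_num)).mul_left 4) hbound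
  let D : H →L[ℂ] H := R + ∑' n, R.comp (boost p q n)
  have hDN : Filter.Tendsto (fun N => R.comp (boostSum p q N)) Filter.atTop (nhds D) := by
    have h1 := (hsum.hasSum.tendsto_sum_nat).const_add R
    refine h1.congr fun N => ?_
    ext x
    simp [boostSum_apply]
  have hDNx : ∀ x, Filter.Tendsto (fun N => R (boostSum p q N x)) Filter.atTop (nhds (D x)) :=
    fun x => ((ContinuousLinearMap.apply ℂ H x).continuous.tendsto D).comp hDN
  have hDadj : ∀ y, Filter.Tendsto (fun N => boostSum p q N (R y)) Filter.atTop
      (nhds (ContinuousLinearMap.adjoint D y)) := fun y => by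
    have h1 := ((ContinuousLinearMap.apply ℂ H y).continuous.tendsto _).comp
      ((ContinuousLinearMap.adjoint (𝕜 := ℂ) (E := H) (F := H)).continuous.tendsto D |>.comp hDN)
    refine h1.congr fun N => ?_
    refine ext_inner_right ℂ fun z => ?_
    change ⟪ContinuousLinearMap.adjoint (R.comp (boostSum p q N)) y, z⟫_ℂ = _
    rw [ContinuousLinearMap.adjoint_inner_left, ContinuousLinearMap.comp_apply, ← hR,
      ← inner_boostSum_left]
  -- `p n` is an eigenvector of `boostSum p q N` once `N > n`, so the sequence with limit `⟪D x, w⟫`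
  -- is eventually constant.
  have hDp : ∀ n w x, R w = p n → ⟪D x, w⟫_ℂ = (4 : ℂ) ^ n * ⟪x, p n⟫_ℂ := fun n w x hw => by
    have h1 : Filter.Tendsto (fun N => ⟪R (boostSum p q N x), w⟫_ℂ) Filter.atTop
        (nhds ⟪D x, w⟫_ℂ) := (hDNx x).inner tendsto_const_nhds
    refine tendsto_nhds_unique h1 (tendsto_const_nhds.congr' ?_)
    filter_upwards [Filter.eventually_gt_atTop n] with N hN
    rw [hR, hw, inner_boostSum_left, boostSum_apply_left hp hpq hN, inner_smul_right]
  have hDq : ∀ n w x, R w = q n → ⟪D x, w⟫_ℂ = ((4 : ℂ) ^ n)⁻¹ * ⟪x, q n⟫_ℂ := fun n w x hw => by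
    have h1 : Filter.Tendsto (fun N => ⟪R (boostSum p q N x), w⟫_ℂ) Filter.atTop
        (nhds ⟪D x, w⟫_ℂ) := (hDNx x).inner tendsto_const_nhds
    refine tendsto_nhds_unique h1 (tendsto_const_nhds.congr' ?_)
    filter_upwards [Filter.eventually_gt_atTop n] with N hN
    rw [hR, hw, inner_boostSum_left, boostSum_apply_right hq hpq hN, inner_smul_right]
  refine ⟨D, ?_, fun y => ?_, ?_⟩
  -- If `D x = 0`, then `x` is orthogonal to every `p n` and `q n`; all boosts vanish at `x`, and `D
  -- x = R x`.
  · rw [injective_iff_map_eq_zero]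
    intro x hx
    have h4 : ∀ n, (4 : ℂ) ^ n ≠ 0 := fun n => pow_ne_zero n (by norm_num)
    have hpx : ∀ n, ⟪p n, x⟫_ℂ = 0 := fun n => by
      obtain ⟨w, hw⟩ := hpR n
      have h1 := hDp n w x hw
      rw [hx, inner_zero_left, zero_eq_mul] at h1
      rw [← inner_conj_symm, h1.resolve_left (h4 n), map_zero]
    have hqx : ∀ n, ⟪q n, x⟫_ℂ = 0 := fun n => by
      obtain ⟨w, hw⟩ := hqR n
      have h1 := hDq n w x hw
      rw [hx, inner_zero_left, zero_eq_mul] at h1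
      rw [← inner_conj_symm, h1.resolve_left (inv_ne_zero (h4 n)), map_zero]
    apply hRinj
    rw [map_zero, ← hx]
    refine tendsto_nhds_unique (tendsto_const_nhds.congr fun N => ?_) (hDNx x)
    rw [boostSum_apply, Finset.sum_eq_zero, add_zero]
    intro n _
    rw [boost_apply, hpx, hqx]
    simp
  · have h1 : Filter.Tendsto (fun N => (R.comp (boostSum p q N)) (J (boostSum p q N (R y))))
        Filter.atTop (nhds (D (J (ContinuousLinearMap.adjoint D y)))) :=
      ((isBoundedBilinearMap_apply (𝕜 := ℂ) (E := H) (F := H)).continuous.tendsto (D, _)).comp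
        (hDN.prodMk_nhds ((J.continuous.tendsto _).comp (hDadj y)))
    refine tendsto_nhds_unique h1 (tendsto_const_nhds.congr fun N => ?_)
    rw [ContinuousLinearMap.comp_apply, boostSum_J_boostSum hJ hJp hJq hp hq hpq]
  · obtain ⟨x, hx⟩ := exists_inner_eq_of_orthonormal hp
    refine ⟨x, fun y hy => ?_⟩
    -- If `D x = R y` and `R w = p n`, then `⟪y, p n⟫ = ⟪D x, w⟫ = 4ⁿ · 2⁻ⁿ`.
    have h1 : ∀ n, (2 : ℝ) ^ n ≤ ‖y‖ := fun n => by
      obtain ⟨w, hw⟩ := hpR n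
      have h2 := hDp n w x hw
      rw [hy, hR, hw, hx, ← mul_pow] at h2
      have h3 := norm_inner_le_norm (𝕜 := ℂ) y (p n)
      rw [h2, hp.1 n, mul_one, norm_pow] at h3
      norm_num at h3
      exact h3
    obtain ⟨n, hn⟩ := pow_unbounded_of_one_lt ‖y‖ (one_lt_two (α := ℝ))
    exact absurd (h1 n) (not_le.2 hn)

end HyperbolicRotation

/-! ### Assembly -/

section Main

variable {H : Type u} [NormedAddCommGroup H] [InnerProductSpace ℂ H] [CompleteSpace H]
variable {T : H →ₗ.[ℂ] H} {S : H →L[ℂ] H}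

theorem isSelfAdjoint_inverse (hT : IsSelfAdjoint T)
    (hTS : ∀ y : H, ∃ h : S y ∈ T.domain, T ⟨S y, h⟩ = y) : IsSelfAdjoint S := by
  rw [ContinuousLinearMap.isSelfAdjoint_iff_isSymmetric]
  exact inner_inverse_left hT hTS

theorem injective_inverse {H : Type u} [NormedAddCommGroup H] [InnerProductSpace ℂ H]
    {T : H →ₗ.[ℂ] H} {S : H →L[ℂ] H} (hTS : ∀ y : H, ∃ h : S y ∈ T.domain, T ⟨S y, h⟩ = y) :
    Function.Injective S := fun x y hxy => by
  obtain ⟨hx, hx'⟩ := hTS x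
  obtain ⟨hy, hy'⟩ := hTS y
  rw [← hx', ← hy']
  congr 2

/-- The spectrum of the inverse of an operator that is not semibounded accumulates at zero from
both sides. -/
theorem spectrum_accumulates (hS : IsSelfAdjoint S) (hST : ∀ x : T.domain, S (T x) = x)
    (h : ¬ Semibounded T) :
    (∀ ε > 0, ∃ s ∈ spectrum ℝ S, 0 < s ∧ s < ε) ∧
      ∀ ε > 0, ∃ s ∈ spectrum ℝ (-S), 0 < s ∧ s < ε := by
  have hsymm : ∀ x : T.domain, (⟪T x, (x : H)⟫_ℂ).re = (⟪S (T x), T x⟫_ℂ).re := fun x => by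
    rw [hST]
    exact inner_re_symm (𝕜 := ℂ) _ _
  constructor <;> intro ε hε <;> by_contra! hc <;> apply h
  · refine ⟨ε⁻¹, Or.inr fun x => ?_⟩
    rw [hsymm]
    refine (re_inner_le_of_spectrum_gap hS hε hc (T x)).trans_eq ?_
    rw [hST]
  · refine ⟨-ε⁻¹, Or.inl fun x => ?_⟩
    rw [hsymm]
    have := re_inner_le_of_spectrum_gap hS.neg hε hc (T x)
    rw [neg_apply, inner_neg_left, norm_neg, Complex.neg_re] at this
    rw [hST] at this ⊢
    linarith

/-- Eigenvectors of `J` for `1` and `-1` on which `R` decays rapidly yield hyperbolic pairs. -/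
theorem exists_hyperbolic_pairs {H : Type u} [NormedAddCommGroup H] [InnerProductSpace ℂ H]
    {R J : H →L[ℂ] H} (hJ : ∀ x y, ⟪J x, y⟫_ℂ = ⟪x, J y⟫_ℂ)
    {u v : ℕ → H} (hu : Orthonormal ℂ u) (hv : Orthonormal ℂ v) (hJu : ∀ n, J (u n) = u n)
    (hJv : ∀ n, J (v n) = -v n) (huR : ∀ n, ∃ w, R w = u n) (hvR : ∀ n, ∃ w, R w = v n)
    (hu' : ∀ n, ‖R (u n)‖ ≤ (1 / 8) ^ n) (hv' : ∀ n, ‖R (v n)‖ ≤ (1 / 8) ^ n) :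
    ∃ p q : ℕ → H, (∀ n, J (p n) = q n) ∧ (∀ n, J (q n) = p n) ∧ Orthonormal ℂ p ∧
      Orthonormal ℂ q ∧ (∀ m n, ⟪p m, q n⟫_ℂ = 0) ∧ (∀ n, ∃ w, R w = p n) ∧
      (∀ n, ∃ w, R w = q n) ∧ (∀ n, ‖R (p n)‖ ≤ 2 * (1 / 8) ^ n) ∧
      ∀ n, ‖R (q n)‖ ≤ 2 * (1 / 8) ^ n := by
  -- Eigenvectors of the symmetric `J` for different eigenvalues are orthogonal.
  have huv : ∀ m n, ⟪u m, v n⟫_ℂ = 0 := fun m n => by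
    have h1 := hJ (u m) (v n)
    rw [hJu, hJv, inner_neg_right] at h1
    exact self_eq_neg.1 h1
  have hvu : ∀ m n, ⟪v m, u n⟫_ℂ = 0 := fun m n => by
    rw [← inner_conj_symm, huv, map_zero]
  let c : ℂ := ((√2)⁻¹ : ℝ)
  have hcc : c * c = 1 / 2 := by
    simp only [c]
    rw [← Complex.ofReal_mul, ← mul_inv, Real.mul_self_sqrt (by norm_num)]
    norm_num
  have hconj : conj c = c := Complex.conj_ofReal _
  have hc : ‖c‖ ≤ 1 := by
    simp only [c]
    rw [Complex.norm_real, norm_inv, Real.norm_of_nonneg (Real.sqrt_nonneg 2)]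
    exact inv_le_one_of_one_le₀ (Real.one_le_sqrt.2 (by norm_num))
  have hRle : ∀ n (x : H), ‖x‖ ≤ ‖R (u n)‖ + ‖R (v n)‖ → ‖c • x‖ ≤ 2 * (1 / 8) ^ n :=
    fun n x hx => by
      rw [norm_smul]
      calc ‖c‖ * ‖x‖ ≤ 1 * (‖R (u n)‖ + ‖R (v n)‖) := by gcongr
        _ ≤ 2 * (1 / 8) ^ n := by linarith [hu' n, hv' n]
  have hu1 := orthonormal_iff_ite.1 hu
  have hv1 := orthonormal_iff_ite.1 hv
  refine ⟨fun n => c • (u n + v n), fun n => c • (u n - v n), fun n => ?_, fun n => ?_,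
    orthonormal_iff_ite.2 fun m n => ?_, orthonormal_iff_ite.2 fun m n => ?_, fun m n => ?_,
    fun n => ?_, fun n => ?_, fun n => ?_, fun n => ?_⟩
  · simp only [map_smul, map_add, hJu, hJv, sub_eq_add_neg]
  · simp only [map_smul, map_sub, hJu, hJv, sub_neg_eq_add]
  · simp only [inner_smul_left, inner_smul_right, inner_add_left, inner_add_right, huv, hvu, hu1,
      hv1, hconj]
    split_ifs
    · linear_combination 2 * hcc
    · ring
  · simp only [inner_smul_left, inner_smul_right, inner_sub_left, inner_sub_right, huv, hvu, hu1,
      hv1, hconj]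
    split_ifs
    · linear_combination 2 * hcc
    · ring
  · simp only [inner_smul_left, inner_smul_right, inner_add_left, inner_sub_right, huv, hvu, hu1,
      hv1, hconj]
    ring
  · obtain ⟨a, ha⟩ := huR n
    obtain ⟨b, hb⟩ := hvR n
    exact ⟨c • (a + b), by rw [map_smul, map_add, ha, hb]⟩
  · obtain ⟨a, ha⟩ := huR n
    obtain ⟨b, hb⟩ := hvR n
    exact ⟨c • (a - b), by rw [map_smul, map_sub, ha, hb]⟩
  · rw [map_smul, map_add]
    exact hRle n _ (norm_add_le _ _)
  · rw [map_smul, map_sub]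
    exact hRle n _ (norm_sub_le _ _)

/-- There is a Kreĭn space completion, and if `T` is not semibounded, there is another. -/
theorem exists_mem_completions (hT : IsSelfAdjoint T) (hinv : BoundedlyInvertible T) :
    ∃ k ∈ completions T hT, ¬ Semibounded T → ∃ l ∈ completions T hT, l ≠ k := by
  obtain ⟨S, hST, hTS⟩ := hinv
  have hS := isSelfAdjoint_inverse hT hTS
  have hSinj := injective_inverse hTS
  obtain ⟨J, hJ, hJJ, hJR⟩ := exists_sign hS hSinj
  have hRJR : ∀ y, S y = sqrtAbs S (J (sqrtAbs S y)) := fun y => by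
    rw [hJR, sqrtAbs_signSqrt_apply hS]
  refine ⟨rangeFormSubspace (sqrtAbs S) (sqrtAbs_injective hS hSinj) J,
    rangeFormSubspace_mem_completions hT hST hTS _ _ J hJ hJJ
      (fun y => by rw [adjoint_sqrtAbs, hRJR]), fun hsemi => ?_⟩
  obtain ⟨hpos, hneg⟩ := spectrum_accumulates hS hST hsemi
  obtain ⟨u, hu, huR, hu'⟩ := exists_orthonormal_of_spectrum hS hpos
  obtain ⟨v, hv, hvR, hv'⟩ := exists_orthonormal_of_spectrum hS.neg hneg
  -- Passing to `-S` keeps `|S|^(1/2)` and reverses the sign, so the `v n` are eigenvectors of `J`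
  -- for `-1`.
  simp only [sqrtAbs_neg S hS, signSqrt_neg S hS] at hvR hv'
  obtain ⟨p, q, hJp, hJq, hp, hq, hpq, hpR, hqR, hp', hq'⟩ := exists_hyperbolic_pairs
    (R := sqrtAbs S) hJ hu hv
    (fun n => by
      obtain ⟨w, hw, hw'⟩ := huR n
      rw [← hw, hJR, hw', hw])
    (fun n => by
      obtain ⟨w, hw, hw'⟩ := hvR n
      rw [neg_apply] at hw'
      rw [← hw, hJR, hw, ← hw', neg_neg])
    (fun n => (huR n).imp fun _ h => h.1) (fun n => (hvR n).imp fun _ h => h.1) hu' hv'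
  obtain ⟨D, hD, hDJD, x, hx⟩ := exists_factorization (inner_sqrtAbs_left S)
    (sqrtAbs_injective hS hSinj) hJ hJp hJq hp hq hpq hpR hqR hp' hq'
  refine ⟨rangeFormSubspace D hD J, rangeFormSubspace_mem_completions hT hST hTS D hD J hJ hJJ
    (fun y => by rw [hDJD, hRJR]), fun heq => ?_⟩
  have h1 : D x ∈ (rangeFormSubspace D hD J).space := ⟨x, rfl⟩
  rw [heq] at h1
  obtain ⟨y, hy⟩ := h1
  exact hx y hy.symm

end Main

end KreinForm

theorem mainTheorem3 {H : Type*} [NormedAddCommGroup H] [InnerProductSpace ℂ H] [CompleteSpace H]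
    (T : H →ₗ.[ℂ] H) (hT : IsSelfAdjoint T) (hinv : KreinForm.BoundedlyInvertible T) :
    ((∃! t, t ∈ KreinForm.closures T hT) ↔ KreinForm.Semibounded T) ∧
    ((∃! k, k ∈ KreinForm.completions T hT) ↔ KreinForm.Semibounded T) ∧
    ((∃! k, k ∈ KreinForm.completionsOp T hT) ↔ KreinForm.Semibounded T) := by
  obtain ⟨k, hk, hk'⟩ := KreinForm.exists_mem_completions hT hinv
  have huniq : KreinForm.Semibounded T → ∀ s ∈ KreinForm.closures T hT,
      ∀ t ∈ KreinForm.closures T hT, s = t := fun h s hs t ht =>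
    (KreinForm.isExtension_of_semibounded hinv h hs ht).antisymm
      (KreinForm.isExtension_of_semibounded hinv h ht hs)
  have hcomp : (∃! k, k ∈ KreinForm.completions T hT) ↔ KreinForm.Semibounded T := by
    refine ⟨fun h => ?_, fun h => ⟨k, hk, fun l hl => ?_⟩⟩
    · by_contra hsemi
      obtain ⟨l, hl, hlk⟩ := hk' hsemi
      exact hlk (h.unique hl hk)
    · exact KreinForm.FormSubspace.toSymForm_inj hl hk
        (huniq h _ (l.toSymForm_mem_closures hl) _ (k.toSymForm_mem_closures hk))
  refine ⟨⟨fun h => ?_, fun h => ⟨k.toSymForm hk, k.toSymForm_mem_closures hk, fun t ht =>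
    huniq h t ht _ (k.toSymForm_mem_closures hk)⟩⟩, hcomp,
    KreinForm.existsUnique_completionsOp_iff.trans hcomp⟩
  by_contra hsemi
  obtain ⟨l, hl, hlk⟩ := hk' hsemi
  exact hlk (KreinForm.FormSubspace.toSymForm_inj hl hk
    (h.unique (l.toSymForm_mem_closures hl) (k.toSymForm_mem_closures hk)))
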